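/- For integers $n\ge 0$ let $p(n)$ be the number of partitions of $n$. The rank of a partition is its largest part minus the number of its parts (the empty partition has rank $0$); for $m\in\mathbb{Z}$ let $N(m,n)$ be the number of partitions of $n$ with rank equal to $m$. Define the symmetrized second rank moment $$\eta_2(n):=\sum_{m=-\infty}^{\infty}\binom{m}{2}N(m,n),\qquad \binom{m}{2}=\frac{m(m-1)}{2},$$ a finite sum for each $n$. Then, as $n\to\infty$, $$\eta_2(n)\sim\frac{1}{4\sqrt{3}}\,e^{\frac{\pi}{6}\sqrt{24n-1}}.$$ In particular, as $n\to\infty$, $\eta_2(n)\sim n\,p(n)$. Here $f(n)\sim g(n)$ means $f(n)/g(n)\to 1$. -/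

import Mathlib

open Filter Asymptotics

/-- Dyson's rank of a partition: its largest part minus the number of its parts
(with the usual value `0` for the empty partition of `0`). -/
def dysonRank {n : ℕ} (P : n.Partition) : ℤ :=
  (P.parts.sup : ℤ) - (P.parts.card : ℤ)

/-- `N(m, n)`: the number of partitions of `n` whose rank equals `m`. -/
def rankCount (m : ℤ) (n : ℕ) : ℕ :=
  Fintype.card {P : n.Partition // dysonRank P = m}

/-- The partition function: the number of partitions of `n`. -/
def partitionCount (n : ℕ) : ℕ :=
  Fintype.card n.Partition

/-- The symmetrized second moment of the rank, the sum over all integers `m` of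
`binom(m, 2) * N(m, n)`. Here `Ring.choose m 2` is the generalized binomial coefficient
`m (m - 1) / 2`, which is defined for negative `m` as well. -/
noncomputable def eta2 (n : ℕ) : ℤ :=
  ∑ᶠ m : ℤ, Ring.choose m 2 * (rankCount m n : ℤ)

/-- Only finitely many integers `m` contribute to the sum that defines `eta2 n`. -/
theorem finite_support_eta2 (n : ℕ) :
    (Function.support fun m : ℤ => Ring.choose m 2 * (rankCount m n : ℤ)).Finite := by
  refine (Set.finite_range (dysonRank (n := n))).subset fun m hm => ?_
  by_contra h
  refine hm ?_
  have h0 : rankCount m n = 0 :=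
    Fintype.card_eq_zero_iff.2 ⟨fun P => h ⟨P.1, P.2⟩⟩
  simp [h0]

/-!
The second moment is governed by an exact formula. Since `binom(r, 2)` is the coefficient of `ε²`
in `(1 + ε)^r` for every integer `r`, `η₂(n)` is the coefficient of `ε² qⁿ` in `∑ z^rank q^size` at `z = 1 + ε`. A case of the
Rogers–Fine identity (`X_pow_dvd_rankSeries_sub`) rewrites that series as
`∑_d q^{d²} / ∏_{i≤d} (1 - z qⁱ) (1 - z⁻¹ qⁱ)`, in which `z` enters only through
`z + z⁻¹ - 2 = ε² + O(ε³)`. Reading off the coefficient (`eta2_eq_sum`) gives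
`η₂(n) = [qⁿ] ∑_d D_d ∑_{i≤d} qⁱ / (1 - qⁱ)²` with `D_d = q^{d²} / ∏_{i≤d} (1 - qⁱ)²`.

The series `D_d` add up to the generating function of `p(n)`, and the logarithmic derivative of
Euler's product gives `n p(n) = [qⁿ] ∑_d D_d ∑_i qⁱ / (1 - qⁱ)²` (`mul_partitionCount`), with no
restriction on `i`. All coefficients are nonnegative, so `η₂(n) ≤ n p(n)`. For any `K` the
difference is at most a contribution of `d, i ≤ K`, of polynomial growth, plus
`∑_{i>K} ∑_j j p(n - i j)` (`le_eta2_add`). As `p(n - m) ≪ p(n) e^{-c m / √n}`, the last sum is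
`O(n p(n) / K)`; letting `K` grow yields `η₂(n) ∼ n p(n)`.

What remains is the Hardy–Ramanujan formula `n p(n) ∼ e^{π √(24 n - 1) / 6} / (4 √3)`
(`mul_partitionCount_isEquivalent`), which also supplies the bound on `p(n - m)`. It is proved by
the circle method on `|q| = e^{-τ}` with a single major arc `|arg q| ≤ τ`. There the modular
transformation of Dedekind's `η` (`eulerInv_exp_neg`) turns Cauchy's integral into a Gaussian one.
Elsewhere `norm_eulerInv_le` shows that Euler's product is smaller by a factor `e^{-c / τ}`.
-/

noncomputable section

namespace PartitionRank

/-! ### Truncated q-series -/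

section

open PowerSeries Finset

section QSeries

variable {A : Type*} [CommRing A]

/-- The geometric series `∑ⱼ cʲ Xⁱʲ = 1 / (1 - c Xⁱ)` (for `i ≥ 1`). -/
def geom (c : A) (i : ℕ) : A⟦X⟧ :=
  mk fun n => if i ∣ n then c ^ (n / i) else 0

lemma one_sub_mul_geom (c : A) {i : ℕ} (hi : 0 < i) :
    (1 - C c * X ^ i) * geom c i = 1 := by
  ext n
  rw [sub_mul, one_mul, map_sub, mul_assoc, coeff_C_mul, coeff_X_pow_mul', coeff_one]
  rcases lt_or_ge n i with h | h
  · rcases Nat.eq_zero_or_pos n with rfl | h0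
    · simp [geom, hi.ne']
    · have : ¬ i ∣ n := Nat.not_dvd_of_pos_of_lt h0 h
      simp [geom, this, h.not_ge, h0.ne']
  · obtain ⟨m, rfl⟩ := Nat.exists_eq_add_of_le h
    by_cases h1 : i ∣ m <;> simp [geom, h1, Nat.add_div_left _ hi, pow_succ, hi.ne', mul_comm]

/-- The partial product `∏_{i=1}^{ℓ} 1 / (1 - y X^{k+i})`. -/
def geomProd (y : A) (k ℓ : ℕ) : A⟦X⟧ := ∏ i ∈ range ℓ, geom y (k + i + 1)

lemma geomProd_zero (y : A) (k : ℕ) : geomProd y k 0 = 1 := by simp [geomProd]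

lemma geomProd_succ (y : A) (k ℓ : ℕ) :
    geomProd y k (ℓ + 1) = geomProd y k ℓ * geom y (k + ℓ + 1) := by
  simp [geomProd, prod_range_succ]

lemma geomProd_succ' (y : A) (k ℓ : ℕ) :
    geomProd y k (ℓ + 1) = geom y (k + 1) * geomProd y (k + 1) ℓ := by
  simp only [geomProd, prod_range_succ', add_zero]
  rw [mul_comm]
  congr 1
  exact prod_congr rfl fun i _ => by congr 1; ring

lemma geomProd_succ_sub (y : A) (k ℓ : ℕ) :
    geomProd y k (ℓ + 1) - geomProd y k ℓ = C y * X ^ (k + ℓ + 1) * geomProd y k (ℓ + 1) := by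
  rw [geomProd_succ]
  linear_combination (geomProd y k ℓ) * one_sub_mul_geom y (i := k + ℓ + 1) (by omega)

/-- The truncated basic hypergeometric sum
`∑_{ℓ<m} x^ℓ X^{(k+1)ℓ} / ∏_{i=1}^{ℓ} (1 - y X^{k+i})`. -/
def fineSum (x y : A) (k m : ℕ) : A⟦X⟧ :=
  ∑ ℓ ∈ range m, C x ^ ℓ * X ^ ((k + 1) * ℓ) * geomProd y k ℓ

/-- The functional equation relating the parameters `k` and `k + 1`; the last term is the truncation
error. -/
lemma one_sub_mul_fineSum (x y : A) (k m : ℕ) :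
    (1 - C x * X ^ (k + 1)) * fineSum x y k (m + 1) =
      1 + C x * C y * X ^ (2 * k + 2) * geom y (k + 1) * fineSum x y (k + 1) m
        - C x ^ (m + 1) * X ^ ((k + 1) * (m + 1)) * geomProd y k m := by
  induction m with
  | zero => simp [fineSum, geomProd_zero]
  | succ m ih =>
    have h1 := geomProd_succ_sub y k m
    have h2 := geomProd_succ' y k m
    have e1 : fineSum x y k (m + 1 + 1) = fineSum x y k (m + 1) +
        C x ^ (m + 1) * X ^ ((k + 1) * (m + 1)) * geomProd y k (m + 1) := sum_range_succ ..
    have e2 : fineSum x y (k + 1) (m + 1) = fineSum x y (k + 1) m +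
        C x ^ m * X ^ ((k + 1 + 1) * m) * geomProd y (k + 1) m := sum_range_succ ..
    rw [e1, e2]
    linear_combination ih + C x ^ (m + 1) * X ^ ((k + 1) * (m + 1)) * h1 +
      C x ^ (m + 1) * X ^ ((k + 1) * (m + 1)) * C y * X ^ (k + m + 1) * h2

/-- The truncation to largest part `< m` of the two-variable series
`1 + y X^k ∑_{ℓ≥1} (x X^{k+1})^ℓ / ∏_{i=1}^{ℓ} (1 - y X^{k+i})`; for `k = 0` this is the generating
function of partitions, with `x` marking the largest part and `y` the number of parts. -/
def rankSeries (x y : A) (k m : ℕ) : A⟦X⟧ := 1 + C y * X ^ k * (fineSum x y k m - 1)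

/-- Splitting off the first step of the Durfee square: modulo `X^{m+1}`, the series at `k` is `1` plus
a multiple of the series at `k + 1`. -/
lemma rankSeries_succ (x y : A) (k m : ℕ) : ∃ E : A⟦X⟧,
    rankSeries x y k (m + 1) =
      1 + C x * C y * X ^ (2 * k + 1) * geom x (k + 1) * geom y (k + 1) * rankSeries x y (k + 1) m
        + X ^ (m + 1) * E := by
  refine ⟨- C y * X ^ k * geom x (k + 1) * C x ^ (m + 1) * X ^ (k * (m + 1)) * geomProd y k m, ?_⟩
  have hx := one_sub_mul_geom x (i := k + 1) (by omega)
  have hy := one_sub_mul_geom y (i := k + 1) (by omega)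
  have hf := one_sub_mul_fineSum x y k m
  have hu : IsUnit ((1 - C x * X ^ (k + 1) : A⟦X⟧)) := IsUnit.of_mul_eq_one _ hx
  have hv : IsUnit ((1 - C y * X ^ (k + 1) : A⟦X⟧)) := IsUnit.of_mul_eq_one _ hy
  apply hu.mul_left_cancel
  apply hv.mul_left_cancel
  simp only [rankSeries]
  generalize geom x (k + 1) = gx at *
  generalize geom y (k + 1) = gy at *
  generalize fineSum x y k (m + 1) = F at *
  generalize fineSum x y (k + 1) m = F' at *
  generalize geomProd y k m = P at *
  linear_combination (C y * X ^ k * (1 - C y * X ^ (k + 1))) * hf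
    - C x * C y * X ^ (2 * k + 1) * (1 + C y * X ^ (k + 1) * (F' - 1)) *
      ((1 - C y * X ^ (k + 1)) * gy * hx + hy)
    + C y * X ^ k * (C x * C y * X ^ (2 * k + 2) * F') * hy
    + C y * X ^ k * (1 - C y * X ^ (k + 1)) * C x ^ (m + 1) * X ^ ((k + 1) * (m + 1)) * P * hx

/-- The summand `(xy)^n X^{n²+2kn} / ∏_{i=1}^{n} (1 - x X^{k+i}) (1 - y X^{k+i})`; for `k = 0` it is
the generating function of partitions with Durfee square of side `n`. -/
def durfeeTerm (x y : A) (k n : ℕ) : A⟦X⟧ :=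
  (C x * C y) ^ n * X ^ (n ^ 2 + 2 * k * n) * (geomProd x k n * geomProd y k n)

lemma durfeeTerm_zero (x y : A) (k : ℕ) : durfeeTerm x y k 0 = 1 := by
  simp [durfeeTerm, geomProd_zero]

lemma durfeeTerm_succ (x y : A) (k n : ℕ) :
    durfeeTerm x y k (n + 1) =
      C x * C y * X ^ (2 * k + 1) * geom x (k + 1) * geom y (k + 1) * durfeeTerm x y (k + 1) n := by
  simp only [durfeeTerm, geomProd_succ']
  ring

/-- A case of the Rogers–Fine identity, in truncated form, by iterating `rankSeries_succ`. -/
lemma X_pow_dvd_rankSeries_sub (x y : A) (k m : ℕ) :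
    X ^ m ∣ rankSeries x y k m - ∑ n ∈ range m, durfeeTerm x y k n := by
  induction m generalizing k with
  | zero => simp
  | succ m ih =>
    obtain ⟨E, hE⟩ := rankSeries_succ x y k m
    obtain ⟨F, hF⟩ := ih (k + 1)
    rw [sum_range_succ', durfeeTerm_zero, hE]
    simp only [durfeeTerm_succ, ← mul_sum]
    refine ⟨C x * C y * X ^ (2 * k) * geom x (k + 1) * geom y (k + 1) * F + E, ?_⟩
    linear_combination (C x * C y * X ^ (2 * k + 1) * geom x (k + 1) * geom y (k + 1)) * hF

/-- The expansion of `1 / (1 - x Xⁱ) (1 - y Xⁱ)` to first order in `s = x + y - 2`, where `x y = 1`. -/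
lemma geom_pair_eq (x y : A) (hxy : x * y = 1) {i : ℕ} (hi : 0 < i) : ∃ E : A⟦X⟧,
    geom x i * geom y i = geom 1 i ^ 2 * (1 + C (x + y - 2) * (X ^ i * geom 1 i ^ 2)) +
      C ((x + y - 2) ^ 2) * E := by
  have hx := one_sub_mul_geom x hi
  have hy := one_sub_mul_geom y hi
  have h1 := one_sub_mul_geom (1 : A) hi
  have hc : (C x * C y : A⟦X⟧) = 1 := by rw [← map_mul, hxy, map_one]
  simp only [map_one, one_mul] at h1
  have hC : (C (x + y - 2) : A⟦X⟧) = C x + C y - 2 := by simp [map_ofNat]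
  refine ⟨geom x i * geom y i * X ^ (2 * i) * geom 1 i ^ 4, ?_⟩
  simp only [map_pow, hC]
  generalize geom x i = gx at *
  generalize geom y i = gy at *
  generalize geom (1 : A) i = g at *
  -- `(1 - x Xⁱ) (1 - y Xⁱ) = (1 - Xⁱ)² - s Xⁱ` with `s = x + y - 2`, since `x y = 1`.
  have hu : (1 - C x * X ^ i) * (1 - C y * X ^ i) =
      (1 - X ^ i) ^ 2 - (C x + C y - 2) * X ^ i := by
    linear_combination X ^ (2 * i) * hc
  have hg : gx * gy * ((1 - X ^ i) ^ 2 - (C x + C y - 2) * X ^ i) = 1 := by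
    rw [← hu]; linear_combination (1 - C y * X ^ i) * gy * hx + hy
  have hg2 : (1 - X ^ i) ^ 2 * g ^ 2 = 1 := by
    linear_combination ((1 - X ^ i) * g + 1) * h1
  generalize C x + C y - 2 = s at *
  linear_combination (g ^ 2 * (1 + s * (X ^ i * g ^ 2))) * hg -
    gx * gy * (1 + s * (X ^ i * g ^ 2)) * hg2

/-- To first order in `s = x + y - 2`, where `x y = 1`, the product
`1 / ∏_{i=1}^{n} (1 - x Xⁱ) (1 - y Xⁱ)` has logarithmic derivative `∑_{i=1}^{n} Xⁱ / (1 - Xⁱ)²`. -/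
lemma geomProd_pair_eq (x y : A) (hxy : x * y = 1) (n : ℕ) : ∃ E : A⟦X⟧,
    geomProd x 0 n * geomProd y 0 n =
      geomProd 1 0 n ^ 2 * (1 + C (x + y - 2) *
        ∑ i ∈ range n, X ^ (i + 1) * geom 1 (i + 1) ^ 2) + C ((x + y - 2) ^ 2) * E := by
  induction n with
  | zero => exact ⟨0, by simp [geomProd_zero]⟩
  | succ n ih =>
    obtain ⟨E, hE⟩ := ih
    obtain ⟨F, hF⟩ := geom_pair_eq x y hxy n.succ_pos
    simp only [geomProd_succ, sum_range_succ, zero_add, Nat.succ_eq_add_one] at *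
    simp only [map_pow] at *
    generalize C (x + y - 2) = s at *
    generalize geomProd (1 : A) 0 n = P at *
    generalize geom (1 : A) (n + 1) = g at *
    generalize ∑ i ∈ range n, (X : A⟦X⟧) ^ (i + 1) * geom 1 (i + 1) ^ 2 = S at *
    refine ⟨P ^ 2 * g ^ 2 * (S * (X ^ (n + 1) * g ^ 2)) + P ^ 2 * (1 + s * S) * F +
      E * (geom x (n + 1) * geom y (n + 1)), ?_⟩
    linear_combination (geom x (n + 1) * geom y (n + 1)) * hE + P ^ 2 * (1 + s * S) * hF

end QSeries

end

/-! ### Partitions by largest part and number of parts -/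

section

open PowerSeries Finset

section Combinatorics

variable {A : Type*} [CommRing A]

/-- The partitions of `n` all of whose parts are at most `ℓ`. -/
def partsLE (n ℓ : ℕ) : Finset n.Partition := univ.filter fun P => ∀ i ∈ P.parts, i ≤ ℓ

lemma mem_partsLE {n ℓ : ℕ} {P : n.Partition} : P ∈ partsLE n ℓ ↔ ∀ i ∈ P.parts, i ≤ ℓ := by
  simp [partsLE]

/-- Removing one copy of the largest part. -/
lemma sum_partsLE_mem {n ℓ : ℕ} (h1 : 1 ≤ ℓ) (h2 : ℓ ≤ n) (f : Multiset ℕ → A) :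
    ∑ P ∈ partsLE n ℓ with ℓ ∈ P.parts, f P.parts =
      ∑ P ∈ partsLE (n - ℓ) ℓ, f (ℓ ::ₘ P.parts) := by
  symm
  refine sum_bij' (fun P _ => ((Nat.Partition.partitionWithPartEquiv h1 h2).symm P).1)
    (fun P hP => Nat.Partition.partitionWithPartEquiv h1 h2 ⟨P, (mem_filter.1 hP).2⟩) ?_ ?_ ?_ ?_ ?_
  · intro P hP
    have := ((Nat.Partition.partitionWithPartEquiv h1 h2).symm P).2
    simp only [mem_filter, mem_partsLE, this, and_true]
    simpa [Nat.Partition.partitionWithPartEquiv_symm_apply_parts] using mem_partsLE.1 hP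
  · intro P hP
    rw [mem_partsLE, Nat.Partition.partitionWithPartEquiv_apply_parts]
    exact fun i hi => mem_partsLE.1 (mem_filter.1 hP).1 i (Multiset.mem_of_mem_erase hi)
  · intro P hP; simp
  · intro P hP; simp
  · intro P hP
    simp [Nat.Partition.partitionWithPartEquiv_symm_apply_parts]

lemma partsLE_mem_eq_empty {n ℓ : ℕ} (h : n < ℓ) :
    (partsLE n ℓ).filter (fun P => ℓ ∈ P.parts) = ∅ :=
  filter_eq_empty_iff.2 fun P _ hP => absurd (P.le_of_mem_parts hP) h.not_ge

lemma partsLE_notMem (n ℓ : ℕ) :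
    (partsLE n (ℓ + 1)).filter (fun P => ℓ + 1 ∉ P.parts) = partsLE n ℓ := by
  ext P
  simp only [mem_filter, mem_partsLE]
  constructor
  · rintro ⟨h, h'⟩ i hi
    exact Nat.le_of_lt_succ (lt_of_le_of_ne (h i hi) fun e => h' (by rwa [e] at hi))
  · exact fun h => ⟨fun i hi => (h i hi).trans ℓ.le_succ, fun h' => absurd (h _ h') (by omega)⟩

lemma partsLE_of_le {n ℓ : ℕ} (h : n ≤ ℓ) : partsLE n ℓ = univ :=
  filter_true_of_mem fun P _ _ hi => (P.le_of_mem_parts hi).trans h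

/-- Euler's product, refined by the number of parts. -/
lemma coeff_geomProd (y : A) (ℓ n : ℕ) :
    coeff n (geomProd y 0 ℓ) = ∑ P ∈ partsLE n ℓ, y ^ P.parts.card := by
  have key : geomProd y 0 ℓ = mk fun n => ∑ P ∈ partsLE n ℓ, y ^ P.parts.card := by
    induction ℓ with
    | zero =>
      ext n
      rw [geomProd_zero, coeff_one, coeff_mk]
      split_ifs with hn
      · subst hn
        rw [partsLE_of_le le_rfl]
        simp
      · refine (sum_eq_zero fun P hP => absurd ?_ hn).symm
        rw [← P.parts_sum]
        exact Multiset.sum_eq_zero fun i hi => Nat.le_zero.1 (mem_partsLE.1 hP i hi)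
    | succ ℓ ih =>
      have h := geomProd_succ y 0 ℓ
      rw [zero_add] at h
      have hg := one_sub_mul_geom y ℓ.succ_pos
      have hu : IsUnit ((1 - C y * X ^ (ℓ + 1) : A⟦X⟧)) := IsUnit.of_mul_eq_one _ hg
      refine hu.mul_left_cancel ?_
      rw [h, mul_left_comm, hg, mul_one, ih]
      ext n
      rw [sub_mul, one_mul, map_sub, mul_assoc, coeff_C_mul, coeff_X_pow_mul']
      simp only [coeff_mk]
      rw [← sum_filter_add_sum_filter_not (partsLE n (ℓ + 1)) (fun P => ℓ + 1 ∈ P.parts),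
        partsLE_notMem]
      split_ifs with hn
      · rw [sum_partsLE_mem (by omega) hn (fun s => y ^ s.card), mul_sum]
        simp [pow_succ, mul_comm]
      · rw [partsLE_mem_eq_empty (by omega)]
        simp
  rw [key, coeff_mk]

lemma sup_mem_of_ne_zero {s : Multiset ℕ} (h : s.sup ≠ 0) : s.sup ∈ s := by
  induction s using Multiset.induction_on with
  | empty => simp at h
  | cons a s ih =>
    rw [Multiset.sup_cons] at *
    rcases le_total s.sup a with h' | h'
    · simp [h']
    · rw [sup_eq_right.2 h'] at *
      exact Multiset.mem_cons_of_mem (ih h)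

lemma filter_sup_eq (n : ℕ) {ℓ : ℕ} (h : 1 ≤ ℓ) :
    (univ.filter fun P : n.Partition => P.parts.sup = ℓ) =
      (partsLE n ℓ).filter (fun P => ℓ ∈ P.parts) := by
  ext P
  simp only [mem_filter, mem_univ, true_and, mem_partsLE]
  constructor
  · intro e
    exact ⟨fun i hi => e ▸ Multiset.le_sup hi, by
      have := sup_mem_of_ne_zero (s := P.parts) (by omega)
      rwa [e] at this⟩
  · rintro ⟨h1, h2⟩
    exact le_antisymm (Multiset.sup_le.2 h1) (Multiset.le_sup h2)

/-- `rankSeries x y 0 m` generates partitions by largest part and number of parts: classify by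
the largest part `ℓ` and remove one copy of it. -/
lemma coeff_rankSeries (x y : A) {n m : ℕ} (h : n < m) :
    coeff n (rankSeries x y 0 m) =
      ∑ P : n.Partition, x ^ P.parts.sup * y ^ P.parts.card := by
  obtain ⟨m, rfl⟩ : ∃ k, m = k + 1 := ⟨m - 1, by omega⟩
  have hs : ∀ P ∈ (univ : Finset n.Partition), P.parts.sup ∈ range (m + 1) := fun P _ =>
    mem_range.2 (lt_of_le_of_lt (Multiset.sup_le.2 fun i hi => P.le_of_mem_parts hi) h)
  rw [← sum_fiberwise_of_maps_to hs, sum_range_succ']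
  simp only [rankSeries, fineSum, sum_range_succ' _ m, geomProd_zero]
  simp only [pow_zero, mul_one, mul_zero, zero_add, one_mul, add_sub_cancel_right, map_add,
    coeff_C_mul, map_sum]
  rw [add_comm]
  congr 1
  · rw [mul_sum]
    refine sum_congr rfl fun ℓ hℓ => ?_
    rw [filter_sup_eq n (by omega), mul_assoc, ← map_pow, coeff_C_mul, coeff_X_pow_mul',
      sum_congr rfl (g := fun P => x ^ (ℓ + 1) * y ^ P.parts.card)]
    · split_ifs with hn
      · rw [sum_partsLE_mem (by omega) hn (fun s => x ^ (ℓ + 1) * y ^ s.card), coeff_geomProd,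
          mul_sum, mul_sum]
        exact sum_congr rfl fun P _ => by rw [Multiset.card_cons]; ring
      · rw [partsLE_mem_eq_empty (by omega)]
        simp
    · intro P hP
      rw [← filter_sup_eq n (by omega)] at hP
      rw [(mem_filter.1 hP).2]
  · rw [coeff_one]
    split_ifs with hn
    · subst hn
      simp [filter_true_of_mem]
    · refine (sum_eq_zero fun P hP => absurd ?_ hn).symm
      rw [← P.parts_sum]
      exact Multiset.sum_eq_zero fun i hi =>
        Nat.le_zero.1 ((mem_filter.1 hP).2 ▸ Multiset.le_sup hi)

/-- The sum of `x^(largest part) y^(number of parts)` through Durfee squares. -/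
lemma sum_partition_eq (x y : A) {n m : ℕ} (h : n < m) :
    ∑ P : n.Partition, x ^ P.parts.sup * y ^ P.parts.card =
      ∑ d ∈ range m, coeff n (durfeeTerm x y 0 d) := by
  have := X_pow_dvd_iff.1 (X_pow_dvd_rankSeries_sub x y 0 m) n h
  rw [map_sub, sub_eq_zero, map_sum] at this
  rw [← coeff_rankSeries x y h, this]

end Combinatorics

/-- The generating function of partitions with Durfee square of side `d`. -/
def durfee (d : ℕ) : ℤ⟦X⟧ := X ^ d ^ 2 * geomProd 1 0 d ^ 2

/-- `Xⁱ / (1 - Xⁱ)² = ∑ⱼ j Xⁱʲ`. -/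
def weighted (i : ℕ) : ℤ⟦X⟧ := X ^ i * geom 1 i ^ 2

lemma map_C_geom_one (i : ℕ) : PowerSeries.map (C : ℤ →+* ℤ⟦X⟧) (geom 1 i) = geom 1 i := by
  ext1 n
  rw [coeff_map, geom, geom, coeff_mk, coeff_mk]
  split_ifs <;> simp

lemma map_C_geomProd_one (d : ℕ) :
    PowerSeries.map (C : ℤ →+* ℤ⟦X⟧) (geomProd 1 0 d) = geomProd 1 0 d := by
  simp [geomProd, map_prod, map_C_geom_one]

lemma eta2_eq_sum_choose (n : ℕ) :
    eta2 n = ∑ P : n.Partition, Ring.choose (dysonRank P) 2 := by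
  have h1 : (Function.support fun m : ℤ => Ring.choose m 2 * (rankCount m n : ℤ)) ⊆
      (univ.image (dysonRank (n := n)) : Finset ℤ) := by
    intro m hm
    by_contra h
    refine hm ?_
    have h0 : rankCount m n = 0 :=
      Fintype.card_eq_zero_iff.2 ⟨fun P => h (by simpa using ⟨P.1, P.2⟩)⟩
    simp [h0]
  rw [eta2, finsum_eq_sum_of_support_subset _ h1, ← sum_fiberwise_of_maps_to
    (s := univ) (t := univ.image (dysonRank (n := n))) (g := dysonRank)
    (fun P hP => mem_image_of_mem _ hP)]
  refine sum_congr rfl fun m _ => ?_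
  rw [sum_congr rfl (g := fun _ => Ring.choose m 2) (fun P hP => by rw [(mem_filter.1 hP).2]),
    sum_const, rankCount, Fintype.card_subtype]
  simp [mul_comm]

lemma partitionCount_eq_sum {n m : ℕ} (h : n < m) :
    (partitionCount n : ℤ) = ∑ d ∈ range m, coeff n (durfee d) := by
  have := sum_partition_eq (1 : ℤ) 1 h
  simpa [durfeeTerm, durfee, partitionCount, sq] using this

/-- The symmetrized rank moment through Durfee squares. It is the coefficient of `ε²` in
`∑ z^rank` at `z = 1 + ε`. -/
lemma eta2_eq_sum {n m : ℕ} (h : n < m) :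
    eta2 n = ∑ d ∈ range m, coeff n (durfee d * ∑ i ∈ range d, weighted (i + 1)) := by
  set x : ℤ⟦X⟧ := binomialSeries ℤ (1 : ℤ) with hx
  set y : ℤ⟦X⟧ := binomialSeries ℤ (-1 : ℤ) with hy
  have hxy : x * y = 1 := by rw [hx, hy, ← binomialSeries_add]; simp
  have hpow : ∀ a b : ℕ, x ^ a * y ^ b = binomialSeries ℤ ((a : ℤ) - b) := by
    intro a b
    have ha : ∀ a : ℕ, x ^ a = binomialSeries ℤ (a : ℤ) := fun a => by
      induction a with
      | zero => simp
      | succ a ih => rw [pow_succ, ih, hx, ← binomialSeries_add]; push_cast; rfl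
    have hb : ∀ b : ℕ, y ^ b = binomialSeries ℤ (-(b : ℤ)) := fun b => by
      induction b with
      | zero => simp
      | succ b ih => rw [pow_succ, ih, hy, ← binomialSeries_add]; push_cast; congr 1; ring
    rw [ha, hb, ← binomialSeries_add, sub_eq_add_neg]
  have hL := congrArg (coeff 2) (sum_partition_eq x y h)
  rw [map_sum, map_sum] at hL
  rw [eta2_eq_sum_choose]
  convert hL using 1
  · refine sum_congr rfl fun P _ => ?_
    rw [hpow, binomialSeries_coeff]
    simp [dysonRank]
  · refine sum_congr rfl fun d _ => ?_
    obtain ⟨E, hE⟩ := geomProd_pair_eq x y hxy d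
    have hX : PowerSeries.map (C : ℤ →+* ℤ⟦X⟧) X = X := map_X _
    have hc : (C x * C y : ℤ⟦X⟧⟦X⟧) = 1 := by rw [← map_mul, hxy, map_one]
    have hT : durfeeTerm x y 0 d = PowerSeries.map C (durfee d) +
        C (x + y - 2) * PowerSeries.map C (durfee d * ∑ i ∈ range d, weighted (i + 1)) +
        C ((x + y - 2) ^ 2) * (X ^ d ^ 2 * E) := by
      simp only [durfeeTerm, durfee, weighted, hE, hc, map_mul, map_pow, map_sum, hX,
        map_C_geom_one, map_C_geomProd_one]
      ring
    have hcoeff : ∀ j, coeff j (x + y - 2) =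
        Ring.choose (1 : ℤ) j + Ring.choose (-1 : ℤ) j - if j = 0 then 2 else 0 := by
      intro j
      have h2 : (2 : ℤ⟦X⟧) = C 2 := (map_ofNat C 2).symm
      rw [h2, map_sub, map_add, hx, hy, binomialSeries_coeff, binomialSeries_coeff, coeff_C]
      simp
    have hs : X ^ 2 ∣ x + y - 2 := by
      refine X_pow_dvd_iff.2 fun j hj => ?_
      rw [hcoeff]
      interval_cases j <;> simp
    have hs2 : coeff 2 (x + y - 2) = 1 := by
      have h3 : Ring.choose (-1 : ℤ) 2 = 1 := by
        rw [Ring.choose_neg]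
        have : Ring.choose (2 : ℤ) 2 = 1 := by
          exact_mod_cast Ring.choose_natCast (R := ℤ) 2 2
        norm_num [this, Int.negOnePow_even]
      have h4 : Ring.choose (1 : ℤ) 2 = 0 := by
        exact_mod_cast Ring.choose_natCast (R := ℤ) 1 2
      simp [hcoeff, h3, h4]
    have hs4 : coeff 2 ((x + y - 2) ^ 2 * coeff n (X ^ d ^ 2 * E)) = 0 := by
      have h4 : X ^ 4 ∣ (x + y - 2) ^ 2 * coeff n (X ^ d ^ 2 * E) := by
        refine Dvd.dvd.mul_right ?_ _
        rw [show (4 : ℕ) = 2 * 2 from rfl, pow_mul]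
        exact pow_dvd_pow_of_dvd hs 2
      exact X_pow_dvd_iff.1 h4 2 (by norm_num)
    rw [hT, map_add (coeff n), map_add (coeff n), coeff_C_mul, coeff_C_mul, coeff_map, coeff_map,
      map_add, map_add, hs4, coeff_mul_C, hs2, coeff_C, if_neg two_ne_zero]
    simp

end

/-! ### Coefficient identities and estimates -/

section

open PowerSeries Finset

/-- The generating function of the partition function. -/
def partGF : ℤ⟦X⟧ := mk fun n => (partitionCount n : ℤ)

lemma coeff_weighted {i : ℕ} (hi : 0 < i) (n : ℕ) :
    coeff n (weighted i) = if i ∣ n then ((n / i : ℕ) : ℤ) else 0 := by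
  have hg := one_sub_mul_geom (1 : ℤ) hi
  simp only [map_one, one_mul] at hg
  have key : weighted i = mk fun n => if i ∣ n then ((n / i : ℕ) : ℤ) else 0 := by
    have hu : IsUnit ((1 - X ^ i : ℤ⟦X⟧)) := IsUnit.of_mul_eq_one _ hg
    refine hu.mul_left_cancel ?_
    rw [weighted, show (1 - X ^ i : ℤ⟦X⟧) * (X ^ i * geom 1 i ^ 2) = X ^ i * geom 1 i by
      linear_combination (X ^ i * geom 1 i) * hg]
    ext n
    rw [sub_mul, one_mul, map_sub, coeff_X_pow_mul', coeff_X_pow_mul', coeff_mk]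
    rcases lt_or_ge n i with h | h
    · rcases Nat.eq_zero_or_pos n with rfl | h0
      · simp [hi.ne']
      · have : ¬ i ∣ n := Nat.not_dvd_of_pos_of_lt h0 h
        simp [this, h.not_ge]
    · obtain ⟨m, rfl⟩ := Nat.exists_eq_add_of_le h
      by_cases h1 : i ∣ m <;> simp [geom, h1, Nat.add_div_left _ hi]
  rw [key, coeff_mk]

lemma coeff_mul_nonneg {f g : ℤ⟦X⟧} (hf : ∀ n, 0 ≤ coeff n f) (hg : ∀ n, 0 ≤ coeff n g) (n : ℕ) :
    0 ≤ coeff n (f * g) := by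
  rw [coeff_mul]
  exact sum_nonneg fun p _ => mul_nonneg (hf _) (hg _)

/-- The coefficients are nonnegative and grow at most polynomially. -/
def PolyBounded (f : ℤ⟦X⟧) : Prop :=
  ∃ k : ℕ, ∀ n, 0 ≤ coeff n f ∧ coeff n f ≤ ((n : ℤ) + 1) ^ k

lemma PolyBounded.nonneg {f : ℤ⟦X⟧} (hf : PolyBounded f) (n : ℕ) : 0 ≤ coeff n f :=
  (hf.choose_spec n).1

lemma PolyBounded.mul {f g : ℤ⟦X⟧} (hf : PolyBounded f) (hg : PolyBounded g) :
    PolyBounded (f * g) := by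
  have hf0 := hf.nonneg
  have hg0 := hg.nonneg
  obtain ⟨k, hk⟩ := hf
  obtain ⟨l, hl⟩ := hg
  refine ⟨k + l + 1, fun n => ⟨coeff_mul_nonneg hf0 hg0 n, ?_⟩⟩
  rw [coeff_mul]
  calc ∑ p ∈ antidiagonal n, coeff p.1 f * coeff p.2 g
      ≤ ∑ p ∈ antidiagonal n, ((n : ℤ) + 1) ^ (k + l) := by
        refine sum_le_sum fun p hp => ?_
        have hp' := mem_antidiagonal.1 hp
        rw [pow_add]
        refine mul_le_mul ((hk _).2.trans ?_) ((hl _).2.trans ?_) (hg0 _) (by positivity)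
        · exact pow_le_pow_left₀ (by positivity) (by omega) _
        · exact pow_le_pow_left₀ (by positivity) (by omega) _
    _ = ((n : ℤ) + 1) ^ (k + l + 1) := by
        rw [sum_const, Nat.card_antidiagonal, nsmul_eq_mul]
        push_cast
        ring

lemma polyBounded_one : PolyBounded 1 :=
  ⟨0, fun n => by rw [coeff_one]; split_ifs <;> simp⟩

lemma polyBounded_X_pow (m : ℕ) : PolyBounded (X ^ m) :=
  ⟨0, fun n => by rw [coeff_X_pow]; split_ifs <;> simp⟩

lemma polyBounded_geom (i : ℕ) : PolyBounded (geom 1 i) :=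
  ⟨0, fun n => by rw [geom, coeff_mk]; split_ifs <;> simp⟩

lemma PolyBounded.pow {f : ℤ⟦X⟧} (hf : PolyBounded f) (m : ℕ) : PolyBounded (f ^ m) := by
  induction m with
  | zero => simpa using polyBounded_one
  | succ m ih => rw [pow_succ]; exact ih.mul hf

lemma polyBounded_geomProd (d : ℕ) : PolyBounded (geomProd 1 0 d) := by
  induction d with
  | zero => rw [geomProd_zero]; exact polyBounded_one
  | succ d ih => rw [geomProd_succ]; exact ih.mul (polyBounded_geom _)

lemma polyBounded_durfee (d : ℕ) : PolyBounded (durfee d) :=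
  (polyBounded_X_pow _).mul ((polyBounded_geomProd d).pow 2)

lemma polyBounded_weighted (i : ℕ) : PolyBounded (weighted i) :=
  (polyBounded_X_pow _).mul ((polyBounded_geom i).pow 2)

lemma coeff_mul_congr {f g h : ℤ⟦X⟧} {n : ℕ} (hfg : ∀ k ≤ n, coeff k f = coeff k g) :
    coeff n (f * h) = coeff n (g * h) := by
  rw [coeff_mul, coeff_mul]
  refine sum_congr rfl fun p hp => ?_
  rw [hfg _ (by have := mem_antidiagonal.1 hp; omega)]

lemma coeff_partGF_mul (w : ℤ⟦X⟧) {n m : ℕ} (h : n < m) :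
    coeff n (partGF * w) = ∑ d ∈ range m, coeff n (durfee d * w) := by
  rw [← map_sum, ← sum_mul]
  refine coeff_mul_congr fun k hk => ?_
  rw [partGF, coeff_mk, partitionCount_eq_sum (lt_of_le_of_lt hk h), map_sum]

lemma coeff_geomProd_one_eq {n ℓ : ℕ} (h : n ≤ ℓ) :
    coeff n (geomProd (1 : ℤ) 0 ℓ) = partitionCount n := by
  rw [coeff_geomProd, partsLE_of_le h]
  simp [partitionCount]

lemma X_mul_derivative_geom {i : ℕ} (hi : 0 < i) :
    X * d⁄dX ℤ (geom 1 i) = (i : ℤ⟦X⟧) * X ^ i * geom 1 i * geom 1 i := by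
  have hg := one_sub_mul_geom (1 : ℤ) hi
  simp only [map_one, one_mul] at hg
  have hd := congrArg (fun f => X * d⁄dX ℤ f) hg
  simp only [Derivation.leibniz, map_sub, Derivation.map_one_eq_zero, Derivation.leibniz_pow,
    smul_eq_mul, nsmul_eq_mul, derivative_X, mul_one, mul_zero, zero_sub] at hd
  have hX : (X : ℤ⟦X⟧) * X ^ (i - 1) = X ^ i := by rw [← pow_succ', Nat.sub_add_cancel hi]
  linear_combination (-(X * d⁄dX ℤ (geom 1 i))) * hg + geom 1 i * hd +
    (i : ℤ⟦X⟧) * geom 1 i * geom 1 i * hX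

lemma X_mul_derivative_geomProd (ℓ : ℕ) :
    X * d⁄dX ℤ (geomProd 1 0 ℓ) =
      geomProd 1 0 ℓ * ∑ i ∈ range ℓ, ((i + 1 : ℕ) : ℤ⟦X⟧) * X ^ (i + 1) * geom 1 (i + 1) := by
  induction ℓ with
  | zero => simp [geomProd_zero]
  | succ ℓ ih =>
    have h := X_mul_derivative_geom ℓ.succ_pos
    rw [geomProd_succ, zero_add, sum_range_succ, Derivation.leibniz, smul_eq_mul, smul_eq_mul]
    simp only [Nat.succ_eq_add_one] at h
    linear_combination geomProd 1 0 ℓ * h + geom 1 (ℓ + 1) * ih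

lemma coeff_natCast_mul_geom {i : ℕ} (hi : 0 < i) (n : ℕ) :
    coeff n ((i : ℤ⟦X⟧) * X ^ i * geom 1 i) = if i ∣ n ∧ n ≠ 0 then (i : ℤ) else 0 := by
  rw [mul_assoc, ← map_natCast C, coeff_C_mul, coeff_X_pow_mul']
  rcases lt_or_ge n i with h | h
  · rcases Nat.eq_zero_or_pos n with rfl | h0
    · simp [hi.ne']
    · have : ¬ i ∣ n := Nat.not_dvd_of_pos_of_lt h0 h
      simp [this, h.not_ge]
  · obtain ⟨m, rfl⟩ := Nat.exists_eq_add_of_le h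
    by_cases h1 : i ∣ m <;> simp [geom, h1, hi.ne']

lemma sum_coeff_weighted {n ℓ : ℕ} (h : n ≤ ℓ) :
    ∑ i ∈ range ℓ, coeff n ((((i + 1 : ℕ) : ℤ⟦X⟧)) * X ^ (i + 1) * geom 1 (i + 1)) =
      ∑ i ∈ range ℓ, coeff n (weighted (i + 1)) := by
  simp only [coeff_weighted (Nat.succ_pos _), coeff_natCast_mul_geom (Nat.succ_pos _)]
  rcases Nat.eq_zero_or_pos n with rfl | hn
  · simp
  have hdiv : (range ℓ).filter (fun i => i + 1 ∣ n) = n.divisors.image (fun d => d - 1) := by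
    ext i
    simp only [mem_filter, mem_range, mem_image, Nat.mem_divisors]
    constructor
    · rintro ⟨_, h2⟩
      exact ⟨i + 1, ⟨h2, hn.ne'⟩, rfl⟩
    · rintro ⟨d, ⟨h2, _⟩, rfl⟩
      have := Nat.pos_of_dvd_of_pos h2 hn
      have h3 := Nat.le_of_dvd hn h2
      rw [Nat.sub_add_cancel this]
      exact ⟨by omega, h2⟩
  have hinj : Set.InjOn (fun d : ℕ => d - 1) n.divisors := by
    intro a ha b hb hab
    have := Nat.pos_of_mem_divisors ha
    have := Nat.pos_of_mem_divisors hb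
    simp only at hab
    omega
  simp only [hn.ne', ne_eq, not_false_eq_true, and_true]
  rw [← sum_filter, ← sum_filter, hdiv, sum_image hinj, sum_image hinj]
  have h1 : ∀ f : ℕ → ℤ, ∑ d ∈ n.divisors, f (d - 1 + 1) = ∑ d ∈ n.divisors, f d := fun f =>
    sum_congr rfl fun d hd => by rw [Nat.sub_add_cancel (Nat.pos_of_mem_divisors hd)]
  rw [h1 (fun d => (d : ℤ)), h1 (fun d => ((n / d : ℕ) : ℤ))]
  exact (Nat.sum_div_divisors n (fun d => (d : ℤ))).symm

/-- The logarithmic derivative of Euler's product: `n p(n) = ∑_{i,j≥1} j p(n - i j)`. -/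
lemma mul_partitionCount {n m : ℕ} (h : n < m) :
    (n : ℤ) * partitionCount n = ∑ i ∈ range m, coeff n (partGF * weighted (i + 1)) := by
  have h1 : (n : ℤ) * partitionCount n = coeff n (X * d⁄dX ℤ (geomProd 1 0 m)) := by
    rcases n with _ | n
    · simp
    · rw [coeff_succ_X_mul, coeff_derivative, coeff_geomProd_one_eq h.le]
      push_cast; ring
  rw [h1, X_mul_derivative_geomProd, ← map_sum, ← mul_sum, mul_comm, mul_comm partGF]
  rw [coeff_mul, coeff_mul]
  refine sum_congr rfl fun p hp => ?_
  have hp' := mem_antidiagonal.1 hp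
  rw [map_sum, map_sum, sum_coeff_weighted (by omega), coeff_geomProd_one_eq (by omega),
    partGF, coeff_mk]

lemma coeff_durfee_mul_weighted_nonneg (d i n : ℕ) : 0 ≤ coeff n (durfee d * weighted i) :=
  ((polyBounded_durfee d).mul (polyBounded_weighted i)).nonneg n

lemma eta2_eq_sum_sum (n : ℕ) :
    eta2 n = ∑ d ∈ range (n + 1), ∑ i ∈ range d, coeff n (durfee d * weighted (i + 1)) := by
  rw [eta2_eq_sum n.lt_succ_self]
  simp [mul_sum]

lemma mul_partitionCount_eq_sum_sum (n : ℕ) :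
    (n : ℤ) * partitionCount n =
      ∑ d ∈ range (n + 1), ∑ i ∈ range (n + 1), coeff n (durfee d * weighted (i + 1)) := by
  rw [mul_partitionCount n.lt_succ_self, sum_comm]
  exact sum_congr rfl fun i _ => coeff_partGF_mul _ n.lt_succ_self

/-- `eta2 n` is the part `i ≤ d` of the double sum of nonnegative terms for `n p(n)`. -/
lemma eta2_le (n : ℕ) : eta2 n ≤ n * partitionCount n := by
  rw [eta2_eq_sum_sum, mul_partitionCount_eq_sum_sum]
  refine sum_le_sum fun d hd => sum_le_sum_of_subset_of_nonneg ?_ fun i _ _ =>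
    coeff_durfee_mul_weighted_nonneg d _ n
  have := mem_range.1 hd
  exact range_subset_range.2 (by omega)

/-- A majorant for the part of `∑ (n p(n) - η₂(n)) Xⁿ` that comes from `i ≤ K`; it only involves
partitions whose Durfee square has side less than `K`. -/
def smallPart (K : ℕ) : ℤ⟦X⟧ := (∑ d ∈ range K, durfee d) * ∑ i ∈ range K, weighted (i + 1)

/-- The terms with Durfee side `d ≤ i` missing from `eta2 n` have either `i > K` or `d, i ≤ K`. -/
lemma le_eta2_add {n K : ℕ} (hK : K ≤ n) :
    (n : ℤ) * partitionCount n ≤ eta2 n + coeff n (smallPart K) +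
      ∑ i ∈ Ico K (n + 1), coeff n (partGF * weighted (i + 1)) := by
  have h1 : coeff n (smallPart K) =
      ∑ d ∈ range K, ∑ i ∈ range K, coeff n (durfee d * weighted (i + 1)) := by
    simp [smallPart, sum_mul_sum]
  have h2 : ∑ i ∈ Ico K (n + 1), coeff n (partGF * weighted (i + 1)) =
      ∑ d ∈ range (n + 1), ∑ i ∈ Ico K (n + 1), coeff n (durfee d * weighted (i + 1)) := by
    rw [sum_comm]
    exact sum_congr rfl fun i _ => coeff_partGF_mul _ n.lt_succ_self
  have h3 : ∑ d ∈ range K, ∑ i ∈ range K, coeff n (durfee d * weighted (i + 1)) =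
      ∑ d ∈ range (n + 1), if d < K then
        ∑ i ∈ range K, coeff n (durfee d * weighted (i + 1)) else 0 := by
    rw [← sum_filter]
    congr 1
    ext d
    simp only [mem_filter, mem_range]
    omega
  rw [h1, h2, h3, eta2_eq_sum_sum, mul_partitionCount_eq_sum_sum, ← sum_add_distrib,
    ← sum_add_distrib]
  have h0 := coeff_durfee_mul_weighted_nonneg
  refine sum_le_sum fun d hd => ?_
  rw [← sum_range_add_sum_Ico _ (by omega : K ≤ n + 1)]
  gcongr
  split_ifs with hdK
  · linarith [sum_nonneg fun i (_ : i ∈ range d) => h0 d (i + 1) n]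
  · rw [add_zero]
    exact sum_le_sum_of_subset_of_nonneg (range_subset_range.2 (by omega)) fun i _ _ => h0 d _ n

lemma exists_coeff_smallPart_le (K : ℕ) :
    ∃ (B k : ℕ), ∀ n, coeff n (smallPart K) ≤ B * ((n : ℤ) + 1) ^ k := by
  have h : ∀ d i, ∃ k : ℕ, ∀ n, coeff n (durfee d * weighted (i + 1)) ≤ ((n : ℤ) + 1) ^ k :=
    fun d i => by
      obtain ⟨k, hk⟩ := (polyBounded_durfee d).mul (polyBounded_weighted (i + 1))
      exact ⟨k, fun n => (hk n).2⟩
  choose k hk using h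
  refine ⟨K * K, ∑ d ∈ range K, ∑ i ∈ range K, k d i, fun n => ?_⟩
  have h1 : coeff n (smallPart K) =
      ∑ d ∈ range K, ∑ i ∈ range K, coeff n (durfee d * weighted (i + 1)) := by
    simp [smallPart, sum_mul_sum]
  rw [h1]
  calc _ ≤ ∑ d ∈ range K, ∑ i ∈ range K, ((n : ℤ) + 1) ^ (∑ d ∈ range K, ∑ i ∈ range K, k d i) := by
        refine sum_le_sum fun d hd => sum_le_sum fun i hi => (hk d i n).trans ?_
        refine pow_le_pow_right₀ (by omega) ?_
        exact (single_le_sum (f := fun i => k d i) (fun _ _ => Nat.zero_le _) hi).trans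
          (single_le_sum (f := fun d => ∑ i ∈ range K, k d i) (fun _ _ => Nat.zero_le _) hd)
    _ = _ := by simp [mul_assoc]

/-- The contribution of the multiples of `i`: `∑ⱼ j p(n - i j)`. -/
lemma coeff_partGF_mul_weighted {i : ℕ} (hi : 0 < i) (n : ℕ) :
    coeff n (partGF * weighted i) =
      ∑ j ∈ range (n + 1), if i * j ≤ n then (j : ℤ) * partitionCount (n - i * j) else 0 := by
  rw [mul_comm, coeff_mul, Nat.sum_antidiagonal_eq_sum_range_succ_mk, ← sum_filter]
  simp only [coeff_weighted hi, ite_mul, zero_mul]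
  rw [← sum_filter]
  symm
  refine sum_bij' (fun j _ => i * j) (fun k _ => k / i) ?_ ?_ ?_ ?_ ?_
  · intro j hj
    simp only [mem_filter, mem_range] at *
    exact ⟨by omega, dvd_mul_right _ _⟩
  · intro k hk
    simp only [mem_filter, mem_range] at *
    rw [Nat.mul_div_cancel' hk.2]
    exact ⟨(Nat.div_le_self k i).trans_lt hk.1, by omega⟩
  · intro j hj; exact Nat.mul_div_cancel_left j hi
  · intro k hk; exact Nat.mul_div_cancel' (mem_filter.1 hk).2
  · intro j hj
    simp [Nat.mul_div_cancel_left j hi, partGF]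

end

/-! ### Euler's product as a function on the unit disc -/

section

open PowerSeries Finset Topology

section Evaluation

variable {𝕜 : Type*} [RCLike 𝕜]

lemma hasSum_geom {q : 𝕜} (hq : ‖q‖ < 1) {i : ℕ} (hi : 0 < i) :
    Summable (fun n => ‖coeff n (geom (1 : 𝕜) i) * q ^ n‖) ∧
      ∑' n, coeff n (geom (1 : 𝕜) i) * q ^ n = (1 - q ^ i)⁻¹ := by
  have hinj : Function.Injective (fun j : ℕ => i * j) := fun a b h =>
    Nat.eq_of_mul_eq_mul_left hi h
  have hsupp : ∀ n, n ∉ Set.range (fun j : ℕ => i * j) →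
      coeff n (geom (1 : 𝕜) i) * q ^ n = 0 := by
    intro n hn
    have : ¬ i ∣ n := fun ⟨j, hj⟩ => hn ⟨j, hj.symm⟩
    simp [geom, this]
  have hcomp : ∀ j : ℕ, coeff (i * j) (geom (1 : 𝕜) i) * q ^ (i * j) = (q ^ i) ^ j := by
    intro j
    simp [geom, pow_mul]
  have hqi : ‖q ^ i‖ < 1 := by
    rw [norm_pow]; exact pow_lt_one₀ (norm_nonneg _) hq hi.ne'
  constructor
  · rw [← hinj.summable_iff (fun n hn => by rw [hsupp n hn, norm_zero])]
    simp only [Function.comp_def, hcomp, norm_pow]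
    exact summable_geometric_of_lt_one (by positivity) (by rwa [← norm_pow])
  · refine HasSum.tsum_eq ?_
    rw [← hinj.hasSum_iff hsupp]
    simp only [Function.comp_def, hcomp]
    exact hasSum_geometric_of_norm_lt_one hqi

lemma coeff_mul_pow_eq (f g : 𝕜⟦X⟧) (q : 𝕜) (n : ℕ) :
    coeff n (f * g) * q ^ n =
      ∑ p ∈ antidiagonal n, (coeff p.1 f * q ^ p.1) * (coeff p.2 g * q ^ p.2) := by
  rw [coeff_mul, sum_mul]
  refine sum_congr rfl fun p hp => ?_
  rw [← mem_antidiagonal.1 hp, pow_add]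
  ring

lemma hasSum_geomProd {q : 𝕜} (hq : ‖q‖ < 1) (ℓ : ℕ) :
    Summable (fun n => ‖coeff n (geomProd (1 : 𝕜) 0 ℓ) * q ^ n‖) ∧
      ∑' n, coeff n (geomProd (1 : 𝕜) 0 ℓ) * q ^ n = (∏ i ∈ range ℓ, (1 - q ^ (i + 1)))⁻¹ := by
  induction ℓ with
  | zero =>
    have h0 : ∀ n, n ≠ 0 → coeff n (geomProd (1 : 𝕜) 0 0) * q ^ n = 0 := fun n hn => by
      simp [geomProd_zero, coeff_one, hn]
    constructor
    · exact summable_of_ne_finset_zero (s := {0}) fun n hn => by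
        rw [h0 n (by simpa using hn), norm_zero]
    · rw [tsum_eq_single 0 h0]
      simp [geomProd_zero]
  | succ ℓ ih =>
    have hg := hasSum_geom hq ℓ.succ_pos
    simp only [geomProd_succ, zero_add, coeff_mul_pow_eq]
    set F : ℕ → 𝕜 := fun n => coeff n (geomProd (1 : 𝕜) 0 ℓ) * q ^ n with hF
    set G : ℕ → 𝕜 := fun n => coeff n (geom (1 : 𝕜) (ℓ + 1)) * q ^ n with hG
    change (Summable fun n => ‖∑ p ∈ antidiagonal n, F p.1 * G p.2‖) ∧
      ∑' n, ∑ p ∈ antidiagonal n, F p.1 * G p.2 = _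
    refine ⟨summable_norm_sum_mul_antidiagonal_of_summable_norm (f := F) (g := G) ih.1 hg.1, ?_⟩
    rw [← tsum_mul_tsum_eq_tsum_sum_antidiagonal_of_summable_norm ih.1 hg.1, ih.2, hg.2,
      prod_range_succ, mul_inv]

lemma coeff_geomProd_one (n ℓ : ℕ) :
    coeff n (geomProd (1 : 𝕜) 0 ℓ) = ((partsLE n ℓ).card : 𝕜) := by
  rw [coeff_geomProd]; simp

lemma card_partsLE_of_le {n ℓ : ℕ} (h : n ≤ ℓ) : (partsLE n ℓ).card = partitionCount n := by
  rw [partsLE_of_le h, card_univ, partitionCount]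

lemma card_partsLE_le (n ℓ : ℕ) : (partsLE n ℓ).card ≤ partitionCount n := by
  rw [partitionCount, ← card_univ]; exact card_le_card (subset_univ _)

lemma tprod_one_sub_pow_ne_zero {q : 𝕜} (hq : ‖q‖ < 1) : ∏' n : ℕ, (1 - q ^ (n + 1)) ≠ 0 := by
  simp only [sub_eq_add_neg]
  refine tprod_one_add_ne_zero_of_summable (fun i h => ?_) ?_
  · have h1 : q ^ (i + 1) = 1 := by linear_combination -h
    have h2 := pow_lt_one₀ (norm_nonneg q) hq i.succ_ne_zero
    rw [← norm_pow, Nat.succ_eq_add_one, h1, norm_one] at h2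
    exact lt_irrefl _ h2
  · simp only [norm_neg, norm_pow]
    exact (summable_nat_add_iff 1).2 (summable_geometric_of_lt_one (norm_nonneg _) hq)

lemma tendsto_prod_one_sub_pow {q : 𝕜} (hq : ‖q‖ < 1) :
    Tendsto (fun ℓ => (∏ i ∈ range ℓ, (1 - q ^ (i + 1)))⁻¹) atTop
      (𝓝 (∏' n : ℕ, (1 - q ^ (n + 1)))⁻¹) := by
  refine Tendsto.inv₀ ?_ (tprod_one_sub_pow_ne_zero hq)
  refine (Multipliable.hasProd ?_).tendsto_prod_nat
  simp only [sub_eq_add_neg]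
  apply multipliable_one_add_of_summable
  simp only [norm_neg, norm_pow]
  exact (summable_nat_add_iff 1).2 (summable_geometric_of_lt_one (norm_nonneg _) hq)

lemma summable_partitionCount_mul_pow {r : ℝ} (h0 : 0 ≤ r) (h1 : r < 1) :
    Summable fun n => (partitionCount n : ℝ) * r ^ n := by
  have hr : ‖r‖ < 1 := by rwa [Real.norm_of_nonneg h0]
  obtain ⟨B, hB⟩ := (tendsto_prod_one_sub_pow hr).bddAbove_range
  refine summable_of_sum_range_le (c := B) (fun n => by positivity) fun N => ?_
  refine le_trans ?_ (hB ⟨N, rfl⟩)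
  obtain ⟨hs, ht⟩ := hasSum_geomProd hr N
  simp only
  rw [← ht]
  have hs' := hs.of_norm
  calc ∑ n ∈ range N, (partitionCount n : ℝ) * r ^ n
      = ∑ n ∈ range N, coeff n (geomProd (1 : ℝ) 0 N) * r ^ n := by
        refine sum_congr rfl fun n hn => ?_
        rw [coeff_geomProd_one, card_partsLE_of_le (mem_range.1 hn).le]
    _ ≤ _ := hs'.sum_le_tsum _ fun n _ => by rw [coeff_geomProd_one]; positivity

/-- Euler's product for the generating function of the partition function, as an identity of
functions on the unit disc. -/
lemma hasSum_partitionCount {q : 𝕜} (hq : ‖q‖ < 1) :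
    HasSum (fun n => (partitionCount n : 𝕜) * q ^ n) (∏' n : ℕ, (1 - q ^ (n + 1)))⁻¹ := by
  have hsum : Summable fun n => (partitionCount n : ℝ) * ‖q‖ ^ n :=
    summable_partitionCount_mul_pow (norm_nonneg _) hq
  have hs : Summable fun n => (partitionCount n : 𝕜) * q ^ n :=
    Summable.of_norm (by simpa using hsum)
  have hlim : Tendsto (fun ℓ => ∑' n, coeff n (geomProd (1 : 𝕜) 0 ℓ) * q ^ n) atTop
      (𝓝 (∑' n, (partitionCount n : 𝕜) * q ^ n)) := by
    refine tendsto_tsum_of_dominated_convergence hsum (fun n => ?_) (Eventually.of_forall ?_)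
    · refine tendsto_const_nhds.congr' ?_
      filter_upwards [eventually_ge_atTop n] with ℓ hℓ
      rw [coeff_geomProd_one, card_partsLE_of_le hℓ]
    · intro ℓ n
      rw [coeff_geomProd_one, norm_mul, norm_pow, RCLike.norm_natCast]
      gcongr
      exact card_partsLE_le n ℓ
  simp only [(hasSum_geomProd hq _).2] at hlim
  rw [tendsto_nhds_unique (tendsto_prod_one_sub_pow hq) hlim]
  exact hs.hasSum

end Evaluation

/-- `1 / ∏_{n≥1} (1 - qⁿ)`. -/
def eulerInv (q : ℂ) : ℂ := (∏' n : ℕ, (1 - q ^ (n + 1)))⁻¹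

lemma norm_exp_neg_div_one_sub_le {w : ℂ} (hw : ‖w‖ < 1) :
    ‖Complex.exp (-w) / (1 - w)‖ ≤ Real.exp (-‖w‖) / (1 - ‖w‖) := by
  have h1 := Complex.hasSum_taylorSeries_neg_log hw
  have h2 := Real.hasSum_pow_div_log_of_abs_lt_one (x := ‖w‖) (by rwa [abs_norm])
  have hw1 : (1 - w) ≠ 0 := by
    intro h
    rw [← sub_eq_zero.1 h, norm_one] at hw
    exact lt_irrefl _ hw
  have hr : 0 < 1 - ‖w‖ := by linarith
  -- Drop the terms of degree at most one from the two logarithmic series and compare.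
  have h1' := (hasSum_nat_add_iff' 2).2 h1
  have h2' := (hasSum_nat_add_iff' 1).2 h2
  simp only [sum_range_succ, range_zero, sum_empty] at h1' h2'
  norm_num at h1' h2'
  have hle : ‖-Complex.log (1 - w) - w‖ ≤ -Real.log (1 - ‖w‖) - ‖w‖ := by
    rw [← h1'.tsum_eq, ← h2'.tsum_eq]
    refine tsum_of_norm_bounded h2'.summable.hasSum fun n => ?_
    rw [norm_div, norm_pow]
    have : ‖((n : ℂ) + 2)‖ = (n : ℝ) + 1 + 1 := by
      rw [show ((n : ℂ) + 2) = ((n + 2 : ℕ) : ℂ) by push_cast; ring, Complex.norm_natCast]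
      push_cast; ring
    rw [this]
  have e1 : Complex.exp (-w) / (1 - w) = Complex.exp (-Complex.log (1 - w) - w) := by
    rw [sub_eq_add_neg (-Complex.log _), Complex.exp_add, Complex.exp_neg (Complex.log _), Complex.exp_log hw1]
    rw [div_eq_mul_inv, mul_comm]
  have e2 : Real.exp (-‖w‖) / (1 - ‖w‖) = Real.exp (-Real.log (1 - ‖w‖) - ‖w‖) := by
    rw [sub_eq_add_neg (-Real.log _), Real.exp_add, Real.exp_neg (Real.log _), Real.exp_log hr]
    rw [div_eq_mul_inv, mul_comm]
  rw [e1, e2, Complex.norm_exp]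
  exact Real.exp_le_exp.2 ((Complex.re_le_norm _).trans hle)

/-- Away from the positive real axis Euler's product is exponentially smaller. The function
`exp (-q / (1 - q)) / ∏ (1 - qⁿ)` has nonnegative Taylor coefficients, so that it is largest on the
positive real axis. -/
lemma norm_eulerInv_le {q : ℂ} (hq : ‖q‖ < 1) :
    ‖eulerInv q‖ ≤ ‖eulerInv (‖q‖ : ℂ)‖ *
      Real.exp (-(‖q‖ / (1 - ‖q‖) - ‖q‖ / ‖1 - q‖)) := by
  have hq' : ‖(‖q‖ : ℂ)‖ < 1 := by simpa using hq
  have hqR : ‖‖q‖‖ < 1 := by simpa using hq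
  have hgeom : ∀ x : ℂ, ‖x‖ < 1 → Tendsto (fun ℓ => ∑ i ∈ range ℓ, x ^ (i + 1)) atTop
      (𝓝 (x / (1 - x))) := by
    intro x hx
    have := ((hasSum_geometric_of_norm_lt_one hx).mul_left x).tendsto_sum_nat
    simpa [pow_succ', div_eq_mul_inv] using this
  have hF : ∀ x : ℂ, ‖x‖ < 1 → Tendsto
      (fun ℓ => ‖∏ i ∈ range ℓ, (Complex.exp (-x ^ (i + 1)) / (1 - x ^ (i + 1)))‖) atTop
      (𝓝 ‖Complex.exp (-(x / (1 - x))) * eulerInv x‖) := by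
    intro x hx
    have h := ((Complex.continuous_exp.tendsto _).comp (hgeom x hx).neg).mul
      (tendsto_prod_one_sub_pow hx)
    refine h.norm.congr fun ℓ => ?_
    simp only [Function.comp_apply, prod_div_distrib, ← Complex.exp_sum, sum_neg_distrib]
    rw [div_eq_mul_inv]
  have hle : ‖Complex.exp (-(q / (1 - q))) * eulerInv q‖ ≤
      ‖Complex.exp (-((‖q‖ : ℂ) / (1 - ‖q‖))) * eulerInv (‖q‖ : ℂ)‖ := by
    refine le_of_tendsto_of_tendsto' (hF q hq) (hF _ hq') fun ℓ => ?_
    rw [norm_prod, norm_prod]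
    refine prod_le_prod (fun _ _ => norm_nonneg _) fun i _ => ?_
    have hw : ‖q ^ (i + 1)‖ < 1 := by
      rw [norm_pow]; exact pow_lt_one₀ (norm_nonneg _) hq i.succ_ne_zero
    refine (norm_exp_neg_div_one_sub_le hw).trans (le_of_eq ?_)
    have e : Complex.exp (-(‖q‖ : ℂ) ^ (i + 1)) / (1 - (‖q‖ : ℂ) ^ (i + 1)) =
        ((Real.exp (-‖q ^ (i + 1)‖) / (1 - ‖q ^ (i + 1)‖) : ℝ) : ℂ) := by
      push_cast; simp
    rw [e, Complex.norm_real, Real.norm_of_nonneg]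
    exact div_nonneg (Real.exp_pos _).le (by linarith)
  rw [norm_mul, norm_mul, Complex.norm_exp, Complex.norm_exp] at hle
  have e3 : (-((‖q‖ : ℂ) / (1 - ‖q‖))).re = -(‖q‖ / (1 - ‖q‖)) := by
    have : -((‖q‖ : ℂ) / (1 - ‖q‖)) = ((-(‖q‖ / (1 - ‖q‖)) : ℝ) : ℂ) := by push_cast; rfl
    rw [this, Complex.ofReal_re]
  have e4 : (q / (1 - q)).re ≤ ‖q‖ / ‖1 - q‖ := by
    rw [← norm_div]; exact Complex.re_le_norm _
  rw [e3, Complex.neg_re] at hle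
  set a := ‖q‖ / (1 - ‖q‖)
  set b := ‖q‖ / ‖1 - q‖
  set c := (q / (1 - q)).re
  calc ‖eulerInv q‖ = Real.exp c * (Real.exp (-c) * ‖eulerInv q‖) := by
        rw [← mul_assoc, ← Real.exp_add]; simp
    _ ≤ Real.exp b * (Real.exp (-a) * ‖eulerInv (‖q‖ : ℂ)‖) := by
        gcongr
    _ = _ := by
        rw [neg_sub, sub_eq_add_neg, Real.exp_add]; ring

/-- The modular transformation of Dedekind's `η`, read as a formula for Euler's product. -/
lemma eulerInv_exp_neg {t : ℂ} (ht : 0 < t.re) :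
    eulerInv (Complex.exp (-t)) = (t / (2 * Real.pi)) ^ (1 / 2 : ℂ) *
      Complex.exp (Real.pi ^ 2 / (6 * t) - t / 24) *
        eulerInv (Complex.exp (-(4 * Real.pi ^ 2 / t))) := by
  have hπ : (Real.pi : ℂ) ≠ 0 := by exact_mod_cast Real.pi_ne_zero
  have ht0 : t ≠ 0 := by rintro rfl; simp at ht
  set z : ℂ := Complex.I * (t / (2 * Real.pi)) with hz
  have hre : 0 < (t / (2 * Real.pi)).re := by
    rw [show (2 * Real.pi : ℂ) = ((2 * Real.pi : ℝ) : ℂ) by push_cast; rfl, Complex.div_ofReal_re]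
    positivity
  have him : 0 < z.im := by simpa [hz] using hre
  have hz0 : z ≠ 0 := by rintro h; simp [h] at him
  have heta : ∀ w : ℂ, ModularForm.eta w =
      Complex.exp (2 * Real.pi * Complex.I * w / 24) *
        (eulerInv (Complex.exp (2 * Real.pi * Complex.I * w)))⁻¹ := by
    intro w
    simp [ModularForm.eta, eulerInv, ModularForm.eta_q_eq_pow, Function.Periodic.qParam]
  have hE : ∀ w : ℂ, 0 < w.im → eulerInv (Complex.exp (2 * Real.pi * Complex.I * w)) ≠ 0 := by
    intro w hw
    refine inv_ne_zero (tprod_one_sub_pow_ne_zero ?_)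
    exact UpperHalfPlane.norm_exp_two_pi_I_lt_one ⟨w, hw⟩
  have h := ModularForm.eta_comp_eq_csqrt_I_inv (show z ∈ UpperHalfPlane.upperHalfPlaneSet from him)
  simp only [Function.comp_apply, Pi.smul_apply, Pi.mul_apply, smul_eq_mul] at h
  have hsq : Complex.sqrt z = Complex.sqrt Complex.I * (t / (2 * Real.pi)) ^ (1 / 2 : ℂ) := by
    have hw0 : t / (2 * Real.pi) ≠ 0 := by rintro h0; simp [h0] at hre
    have harg := Complex.abs_arg_lt_pi_div_two_iff.2 (Or.inl hre)
    rw [abs_lt] at harg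
    have hlog : Complex.log z = Complex.log Complex.I + Complex.log (t / (2 * Real.pi)) := by
      refine (Complex.log_mul_eq_add_log_iff Complex.I_ne_zero hw0).2 ?_
      rw [Complex.arg_I]
      constructor <;> linarith [Real.pi_pos]
    rw [Complex.sqrt, Complex.sqrt, Complex.cpow_def_of_ne_zero hz0,
      Complex.cpow_def_of_ne_zero Complex.I_ne_zero, Complex.cpow_def_of_ne_zero hw0, hlog,
      ← Complex.exp_add]
    congr 1
    ring
  have hI : Complex.sqrt Complex.I ≠ 0 := by simp [Complex.sqrt]
  have him' : 0 < (-1 / z).im := by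
    have := UpperHalfPlane.im_inv_neg_coe_pos ⟨z, him⟩
    rwa [show -1 / z = (-z)⁻¹ by rw [inv_neg, neg_div, one_div]]
  have e1 : 2 * Real.pi * Complex.I * z = -t := by
    rw [hz]; field_simp; rw [Complex.I_sq]
  have e2 : 2 * Real.pi * Complex.I * (-1 / z) = -(4 * Real.pi ^ 2 / t) := by
    rw [hz]; field_simp; ring
  have hE1 := hE z him
  have hE2 := hE (-1 / z) him'
  rw [hsq, heta, heta, e1, e2, ← mul_assoc, ← mul_assoc, inv_mul_cancel_left₀ hI] at h
  rw [e1] at hE1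
  rw [e2] at hE2
  have e3 : Complex.exp (Real.pi ^ 2 / (6 * t) - t / 24) =
      Complex.exp (-t / 24) * (Complex.exp (-(4 * Real.pi ^ 2 / t) / 24))⁻¹ := by
    rw [← Complex.exp_neg, ← Complex.exp_add]
    congr 1
    field_simp
    ring
  rw [e3]
  have := Complex.exp_ne_zero (-(4 * Real.pi ^ 2 / t) / 24)
  generalize Complex.exp (-(4 * Real.pi ^ 2 / t) / 24) = u at *
  generalize eulerInv (Complex.exp (-(4 * Real.pi ^ 2 / t))) = E' at *
  generalize eulerInv (Complex.exp (-t)) = E at *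
  generalize (t / (2 * Real.pi)) ^ (1 / 2 : ℂ) = c at *
  generalize Complex.exp (-t / 24) = v at *
  have h' : u * E = c * v * E' := by
    have := congrArg (fun x => x * E * E') h
    calc u * E = u * E'⁻¹ * E * E' := by field_simp
      _ = _ := this
      _ = c * v * E' := by field_simp
  calc E = u⁻¹ * (u * E) := by field_simp
    _ = _ := by rw [h']; ring

end

/-! ### Cauchy's formula and the major arc -/

section

open Topology MeasureTheory

lemma eulerInv_zero : eulerInv 0 = 1 := by simp [eulerInv]

lemma continuousOn_eulerInv : ContinuousOn eulerInv (Metric.ball 0 1) :=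
  (ModularForm.differentiableOn_tprod_one_sub_pow.continuousOn).inv₀ fun q hq =>
    tprod_one_sub_pow_ne_zero (by simpa using hq)

lemma norm_exp_neg_lt_one {t : ℂ} (ht : 0 < t.re) : ‖Complex.exp (-t)‖ < 1 := by
  rw [Complex.norm_exp]
  simpa using ht

lemma continuous_eulerInv_exp_neg {f : ℝ → ℂ} (hf : Continuous f) (h : ∀ x, 0 < (f x).re) :
    Continuous fun x => eulerInv (Complex.exp (-f x)) :=
  continuousOn_eulerInv.comp_continuous (by fun_prop) fun x => by
    simpa using norm_exp_neg_lt_one (h x)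

/-- Cauchy's formula for the coefficient `p(n)`, on the circle of radius `e^{-τ}`. -/
lemma two_pi_mul_partitionCount (n : ℕ) {τ : ℝ} (hτ : 0 < τ) :
    (2 * Real.pi * partitionCount n : ℂ) = ∫ θ in (-Real.pi)..Real.pi,
      eulerInv (Complex.exp (-(τ + θ * Complex.I))) * Complex.exp (n * (τ + θ * Complex.I)) := by
  set F : ℕ → ℝ → ℂ := fun m θ => (partitionCount m : ℂ) *
    Complex.exp (((n : ℂ) - m) * (τ + θ * Complex.I)) with hF
  have hr0 : 0 ≤ Real.exp (-τ) := (Real.exp_pos _).le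
  have hr1 : Real.exp (-τ) < 1 := by simpa using hτ
  have hsum := intervalIntegral.hasSum_integral_of_dominated_convergence (μ := volume)
    (a := -Real.pi) (b := Real.pi) (F := F)
    (f := fun θ => eulerInv (Complex.exp (-(τ + θ * Complex.I))) *
      Complex.exp (n * (τ + θ * Complex.I)))
    (fun m _ => (partitionCount m : ℝ) * Real.exp (-τ) ^ m * Real.exp (n * τ)) ?_ ?_ ?_ ?_ ?_
  · have hint : ∀ m, ∫ θ in (-Real.pi)..Real.pi, F m θ =
        if m = n then (2 * Real.pi * partitionCount n : ℂ) else 0 := by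
      intro m
      split_ifs with hm
      · subst hm
        simp only [hF, sub_self, zero_mul, Complex.exp_zero, mul_one,
          intervalIntegral.integral_const, sub_neg_eq_add, Complex.real_smul]
        push_cast
        ring
      · have hc : ((n : ℂ) - m) * Complex.I ≠ 0 := by
          refine mul_ne_zero (sub_ne_zero.2 ?_) Complex.I_ne_zero
          exact Nat.cast_injective.ne (Ne.symm hm)
        have e1 : ∀ θ : ℝ, F m θ = (partitionCount m : ℂ) * Complex.exp (((n : ℂ) - m) * τ) *
            Complex.exp (((n : ℂ) - m) * Complex.I * θ) := by
          intro θ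
          simp only [hF]
          rw [mul_assoc, ← Complex.exp_add]
          congr 2
          ring
        simp only [e1]
        rw [intervalIntegral.integral_const_mul, integral_exp_mul_complex hc]
        have e2 : Complex.exp (((n : ℂ) - m) * Complex.I * (Real.pi : ℝ)) =
            Complex.exp (((n : ℂ) - m) * Complex.I * ((-Real.pi : ℝ) : ℂ)) := by
          rw [Complex.exp_eq_exp_iff_exists_int]
          exact ⟨(n : ℤ) - m, by push_cast; ring⟩
        rw [e2]
        simp
    simp only [hint] at hsum
    exact (hasSum_ite_eq n _).unique hsum
  · intro m
    exact (by fun_prop : Continuous (F m)).aestronglyMeasurable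
  · intro m
    refine Eventually.of_forall fun θ _ => le_of_eq ?_
    simp only [hF]
    rw [norm_mul, Complex.norm_natCast, Complex.norm_exp, mul_assoc, ← Real.exp_nat_mul,
      ← Real.exp_add]
    congr 2
    simp
    ring
  · refine Eventually.of_forall fun θ _ => ?_
    exact (summable_partitionCount_mul_pow hr0 hr1).mul_right _
  · exact _root_.intervalIntegrable_const
  · refine Eventually.of_forall fun θ _ => ?_
    have hq : ‖Complex.exp (-(τ + θ * Complex.I))‖ < 1 := norm_exp_neg_lt_one (by simpa using hτ)
    have e : (fun m => F m θ) = fun m => (partitionCount m : ℂ) *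
        Complex.exp (-(τ + θ * Complex.I)) ^ m * Complex.exp (n * (τ + θ * Complex.I)) := by
      funext m
      simp only [hF]
      rw [mul_assoc, ← Complex.exp_nat_mul, ← Complex.exp_add]
      congr 2
      ring
    rw [e]
    exact (hasSum_partitionCount hq).mul_right _

/-- The integrand of the circle method near the positive real axis, in the rescaled variable `v`
with `t = τ (1 + i v / √X)`. -/
def saddleIntegrand (X v : ℝ) : ℂ :=
  (1 + (v / √X : ℝ) * Complex.I) ^ (1 / 2 : ℂ) *
    Complex.exp (-((v : ℂ) ^ 2 / (1 + (v / √X : ℝ) * Complex.I))) *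
      eulerInv (Complex.exp (-(24 * X / (1 + (v / √X : ℝ) * Complex.I))))

lemma re_div_one_add (a u : ℝ) : ((a : ℂ) / (1 + u * Complex.I)).re = a / (1 + u ^ 2) := by
  rw [Complex.div_re]
  simp [Complex.normSq_apply]
  ring

lemma one_add_ne_zero (u : ℝ) : (1 + u * Complex.I : ℂ) ≠ 0 := by
  intro h
  have := congrArg Complex.re h
  simp at this

lemma one_add_mem_slitPlane (u : ℝ) : (1 + u * Complex.I : ℂ) ∈ Complex.slitPlane := by
  left; simp

lemma continuous_saddleIntegrand {X : ℝ} (hX : 0 < X) : Continuous (saddleIntegrand X) := by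
  have h1 : Continuous fun v : ℝ => (1 + ((v / √X : ℝ) : ℂ) * Complex.I) := by fun_prop
  refine (Continuous.mul ?_ ?_).mul ?_
  · exact continuous_iff_continuousAt.2 fun v =>
      ContinuousAt.comp (f := fun v : ℝ => (1 + ((v / √X : ℝ) : ℂ) * Complex.I))
        (continuousAt_cpow_const (one_add_mem_slitPlane _)) h1.continuousAt
  · exact Complex.continuous_exp.comp
      ((Continuous.div (by fun_prop) h1 fun v => one_add_ne_zero _).neg)
  · refine continuous_eulerInv_exp_neg (continuous_const.div h1 fun v => one_add_ne_zero _) ?_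
    intro v
    have := re_div_one_add (24 * X) (v / √X)
    push_cast at this ⊢
    rw [this]
    positivity

lemma norm_cpow_half_sq (z : ℂ) : ‖z ^ (1 / 2 : ℂ)‖ ^ 2 = ‖z‖ := by
  rw [← norm_pow, one_div, Complex.cpow_ofNat_inv_pow]

lemma norm_one_add_cpow_le {u : ℝ} (hu : |u| ≤ 1) :
    ‖(1 + u * Complex.I : ℂ) ^ (1 / 2 : ℂ)‖ ≤ 2 := by
  have h1 : ‖(1 + u * Complex.I : ℂ)‖ ≤ 2 := by
    refine (norm_add_le _ _).trans ?_
    simp only [norm_one, norm_mul, Complex.norm_real, Complex.norm_I, mul_one, Real.norm_eq_abs]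
    linarith
  have h2 := norm_cpow_half_sq (1 + u * Complex.I)
  nlinarith [norm_nonneg ((1 + u * Complex.I : ℂ) ^ (1 / 2 : ℂ))]

/-- The dual nome `e^{-24 X / (1 + i u)}` is uniformly small for `|u| ≤ 1`. -/
lemma norm_dual_nome_le {X u : ℝ} (hX : 0 < X) (hu : |u| ≤ 1) :
    ‖Complex.exp (-(24 * X / (1 + u * Complex.I)))‖ ≤ Real.exp (-(12 * X)) := by
  have h := re_div_one_add (24 * X) u
  push_cast at h
  rw [Complex.norm_exp, Complex.neg_re, h, Real.exp_le_exp, neg_le_neg_iff,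
    le_div_iff₀ (by positivity)]
  have : u ^ 2 ≤ 1 := by rw [← sq_abs]; nlinarith [abs_nonneg u]
  nlinarith

lemma eventually_eulerInv : ∀ᶠ X : ℝ in atTop, ∀ q : ℂ, ‖q‖ ≤ Real.exp (-(12 * X)) →
    ‖eulerInv q‖ ≤ 2 := by
  have hc : ContinuousAt eulerInv 0 :=
    continuousOn_eulerInv.continuousAt (Metric.ball_mem_nhds _ one_pos)
  have h1 : ∀ᶠ q in 𝓝 (0 : ℂ), ‖eulerInv q‖ < 2 := by
    refine hc.norm.eventually_lt_const ?_
    simp [eulerInv_zero]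
  obtain ⟨δ, hδ, h2⟩ := Metric.eventually_nhds_iff.1 h1
  have h3 : Tendsto (fun X : ℝ => Real.exp (-(12 * X))) atTop (𝓝 0) :=
    Real.tendsto_exp_neg_atTop_nhds_zero.comp (tendsto_id.const_mul_atTop (by norm_num))
  filter_upwards [h3.eventually_lt_const hδ] with X hδX q hq
  exact (h2 (by simpa using hq.trans_lt hδX)).le

lemma abs_div_sqrt_le {X v : ℝ} (hv : |v| ≤ √X) : |v / √X| ≤ 1 := by
  rw [abs_div, abs_of_nonneg (Real.sqrt_nonneg X)]
  exact div_le_one_of_le₀ hv (Real.sqrt_nonneg X)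

/-- Laplace's method: the rescaled integral over the major arc tends to the Gaussian integral. -/
lemma tendsto_integral_saddleIntegrand :
    Tendsto (fun X => ∫ v in (-√X)..√X, saddleIntegrand X v) atTop (𝓝 (√Real.pi : ℂ)) := by
  have hlim : ∫ v : ℝ, Complex.exp (-(v : ℂ) ^ 2) = (√Real.pi : ℂ) := by
    have h := integral_gaussian 1
    have e : ∀ v : ℝ, Complex.exp (-(v : ℂ) ^ 2) = ((Real.exp (-1 * v ^ 2) : ℝ) : ℂ) := by
      intro v; push_cast; ring_nf
    simp only [e]
    rw [integral_complex_ofReal, h, div_one]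
  rw [← hlim]
  have hev : (fun X => ∫ v : ℝ, (Set.Ioc (-√X) √X).indicator (saddleIntegrand X) v) =ᶠ[atTop]
      fun X => ∫ v in (-√X)..√X, saddleIntegrand X v := by
    filter_upwards [eventually_gt_atTop 0] with X hX
    rw [integral_indicator measurableSet_Ioc, intervalIntegral.integral_of_le]
    linarith [Real.sqrt_nonneg X]
  refine Tendsto.congr' hev ?_
  refine tendsto_integral_filter_of_dominated_convergence
    (fun v => 4 * Real.exp (-(1 / 2) * v ^ 2)) ?_ ?_ ?_ ?_
  · filter_upwards [eventually_gt_atTop 0] with X hX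
    exact (continuous_saddleIntegrand hX).aestronglyMeasurable.indicator measurableSet_Ioc
  · filter_upwards [eventually_gt_atTop 0, eventually_eulerInv] with X hX hE
    refine Eventually.of_forall fun v => ?_
    rw [Set.indicator_apply]
    split_ifs with hv
    · have hu := abs_div_sqrt_le (abs_le.2 ⟨hv.1.le, hv.2⟩)
      rw [saddleIntegrand, norm_mul, norm_mul]
      have h1 := norm_one_add_cpow_le hu
      have h2 := hE _ (norm_dual_nome_le hX hu)
      have h3 : ‖Complex.exp (-((v : ℂ) ^ 2 / (1 + (v / √X : ℝ) * Complex.I)))‖ ≤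
          Real.exp (-(1 / 2) * v ^ 2) := by
        have h := re_div_one_add (v ^ 2) (v / √X)
        rw [Complex.ofReal_pow] at h
        rw [Complex.norm_exp, Complex.neg_re, h, Real.exp_le_exp, neg_mul, neg_le_neg_iff,
          le_div_iff₀ (by positivity)]
        have : (v / √X) ^ 2 ≤ 1 := by rw [← sq_abs]; nlinarith [abs_nonneg (v / √X)]
        nlinarith [sq_nonneg v]
      calc _ ≤ 2 * Real.exp (-(1 / 2) * v ^ 2) * 2 := by gcongr
        _ = _ := by ring
    · rw [norm_zero]; positivity
  · exact (integrable_exp_neg_mul_sq (by norm_num)).const_mul _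
  · refine Eventually.of_forall fun v => ?_
    have hsq : Tendsto (fun X : ℝ => v / √X) atTop (𝓝 0) :=
      Real.tendsto_sqrt_atTop.const_div_atTop v
    have hone : Tendsto (fun X : ℝ => (1 + ((v / √X : ℝ) : ℂ) * Complex.I)) atTop (𝓝 1) := by
      have := ((Complex.continuous_ofReal.tendsto 0).comp hsq).mul_const Complex.I |>.const_add 1
      simpa using this
    have h1 : Tendsto (fun X : ℝ => (1 + ((v / √X : ℝ) : ℂ) * Complex.I) ^ (1 / 2 : ℂ)) atTop
        (𝓝 1) := by
      have := (continuousAt_cpow_const (a := (1 : ℂ)) (b := 1 / 2) (by simp)).tendsto.comp hone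
      rwa [Complex.one_cpow] at this
    have h2 : Tendsto (fun X : ℝ => Complex.exp (-((v : ℂ) ^ 2 /
        (1 + ((v / √X : ℝ) : ℂ) * Complex.I)))) atTop (𝓝 (Complex.exp (-(v : ℂ) ^ 2))) := by
      have := (Complex.continuous_exp.tendsto _).comp
        (((tendsto_const_nhds (x := (v : ℂ) ^ 2)).div hone one_ne_zero).neg)
      rwa [div_one] at this
    have hlarge : ∀ᶠ X : ℝ in atTop, |v| < √X := Real.tendsto_sqrt_atTop.eventually_gt_atTop _
    have h3 : Tendsto (fun X : ℝ => eulerInv (Complex.exp (-(24 * X /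
        (1 + ((v / √X : ℝ) : ℂ) * Complex.I))))) atTop (𝓝 1) := by
      have hc : ContinuousAt eulerInv 0 :=
        continuousOn_eulerInv.continuousAt (Metric.ball_mem_nhds _ one_pos)
      have h4 : Tendsto (fun X : ℝ => Real.exp (-(12 * X))) atTop (𝓝 0) :=
        Real.tendsto_exp_neg_atTop_nhds_zero.comp (tendsto_id.const_mul_atTop (by norm_num))
      have h5 : Tendsto (fun X : ℝ => Complex.exp (-(24 * X /
          (1 + ((v / √X : ℝ) : ℂ) * Complex.I)))) atTop (𝓝 0) := by
        refine squeeze_zero_norm' ?_ h4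
        filter_upwards [eventually_gt_atTop 0, hlarge] with X hX hv
        exact norm_dual_nome_le hX (abs_div_sqrt_le hv.le)
      have := hc.tendsto.comp h5
      rwa [eulerInv_zero] at this
    have h6 := (h1.mul h2).mul h3
    rw [one_mul, mul_one] at h6
    refine h6.congr' ?_
    filter_upwards [hlarge] with X hv
    rw [Set.indicator_of_mem]
    · rfl
    · exact ⟨(abs_lt.1 hv).1, (abs_lt.1 hv).2.le⟩

end

/-! ### The minor arc and the Hardy–Ramanujan formula -/

section

open Topology MeasureTheory

/-- The parameter `τ = π² / (6 X)` of the circle `|q| = e^{-τ}`, which is also the half-width of the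
major arc. -/
def saddleWidth (X : ℝ) : ℝ := Real.pi ^ 2 / (6 * X)

lemma saddleWidth_pos {X : ℝ} (hX : 0 < X) : 0 < saddleWidth X := by
  unfold saddleWidth; positivity

lemma ofReal_mul_cpow_half {r : ℝ} (hr : 0 < r) {z : ℂ} (hz : z ≠ 0) :
    ((r : ℂ) * z) ^ (1 / 2 : ℂ) = (√r : ℂ) * z ^ (1 / 2 : ℂ) := by
  have hr' : (r : ℂ) ≠ 0 := by exact_mod_cast hr.ne'
  have h : (√r : ℂ) = (r : ℂ) ^ (1 / 2 : ℂ) := by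
    rw [Real.sqrt_eq_rpow, Complex.ofReal_cpow hr.le]
    push_cast
    rfl
  rw [h, Complex.cpow_def_of_ne_zero (mul_ne_zero hr' hz), Complex.cpow_def_of_ne_zero hr',
    Complex.cpow_def_of_ne_zero hz, Complex.log_ofReal_mul hr hz, ← Complex.exp_add,
    Complex.ofReal_log hr.le]
  congr 1
  ring

/-- At `n = 1/24 + 6 X² / π²` the circle integrand is `√(τ/2π) e^{2X}` times a function that does
not oscillate near `u = 0`, where `t = τ (1 + i u)`. -/
lemma circle_integrand_eq {X : ℝ} (hX : 0 < X) (u : ℝ) {n : ℕ}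
    (hn : (n : ℝ) = 1 / 24 + 6 * X ^ 2 / Real.pi ^ 2) :
    eulerInv (Complex.exp (-(saddleWidth X + (saddleWidth X * u : ℝ) * Complex.I))) *
        Complex.exp (n * (saddleWidth X + (saddleWidth X * u : ℝ) * Complex.I)) =
      (√(saddleWidth X / (2 * Real.pi)) * Real.exp (2 * X) : ℝ) *
        ((1 + u * Complex.I) ^ (1 / 2 : ℂ) *
          Complex.exp (-((X * u ^ 2) / (1 + u * Complex.I))) *
            eulerInv (Complex.exp (-(24 * X / (1 + u * Complex.I))))) := by
  have hτ := saddleWidth_pos hX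
  have hw0 := one_add_ne_zero u
  set w : ℂ := 1 + u * Complex.I with hw
  have hπ : (Real.pi : ℂ) ≠ 0 := by exact_mod_cast Real.pi_ne_zero
  have hX' : (X : ℂ) ≠ 0 := by exact_mod_cast hX.ne'
  have hτ' : (saddleWidth X : ℂ) = Real.pi ^ 2 / (6 * X) := by
    rw [saddleWidth]; push_cast; rfl
  have hn' : (n : ℂ) = 1 / 24 + 6 * X ^ 2 / Real.pi ^ 2 := by
    have := congrArg (fun x : ℝ => (x : ℂ)) hn
    push_cast at this
    exact this
  have ht : (saddleWidth X + (saddleWidth X * u : ℝ) * Complex.I : ℂ) = saddleWidth X * w := by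
    rw [hw]; push_cast; ring
  have hre : 0 < ((saddleWidth X : ℂ) * w).re := by
    rw [hw]; simpa using hτ
  have e1 : (saddleWidth X : ℂ) * w / (2 * Real.pi) =
      ((saddleWidth X / (2 * Real.pi) : ℝ) : ℂ) * w := by
    push_cast; ring
  have e2 : 4 * (Real.pi : ℂ) ^ 2 / (saddleWidth X * w) = 24 * X / w := by
    rw [hτ']; field_simp; norm_num
  have hu : (u : ℂ) ^ 2 = -(w - 1) ^ 2 := by
    rw [hw]; ring_nf; rw [Complex.I_sq]; ring
  have e3 : Complex.exp (Real.pi ^ 2 / (6 * (saddleWidth X * w)) - saddleWidth X * w / 24) *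
      Complex.exp (n * (saddleWidth X * w)) =
      Complex.exp (2 * X) * Complex.exp (-((X * u ^ 2) / w)) := by
    rw [← Complex.exp_add, ← Complex.exp_add]
    congr 1
    rw [hn', hτ', hu]
    field_simp
    ring
  rw [ht, eulerInv_exp_neg hre, e1, e2, ofReal_mul_cpow_half (by positivity) hw0]
  push_cast
  linear_combination ((√(saddleWidth X / (2 * Real.pi)) : ℝ) : ℂ) * w ^ (1 / 2 : ℂ) *
    eulerInv (Complex.exp (-(24 * X / w))) * e3

/-- The normalization of Cauchy's integral: `2π p(n) ∼ √π * saddleScale X` at `X = saddleParam n`. -/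
def saddleScale (X : ℝ) : ℝ :=
  saddleWidth X / √X * (√(saddleWidth X / (2 * Real.pi)) * Real.exp (2 * X))

lemma saddleScale_pos {X : ℝ} (hX : 0 < X) : 0 < saddleScale X := by
  have := saddleWidth_pos hX
  unfold saddleScale; positivity

lemma major_arc_eq {X : ℝ} (hX : 0 < X) {n : ℕ}
    (hn : (n : ℝ) = 1 / 24 + 6 * X ^ 2 / Real.pi ^ 2) :
    ∫ θ in (-saddleWidth X)..saddleWidth X,
      eulerInv (Complex.exp (-(saddleWidth X + θ * Complex.I))) *
        Complex.exp (n * (saddleWidth X + θ * Complex.I)) =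
      (saddleScale X : ℂ) * ∫ v in (-√X)..√X, saddleIntegrand X v := by
  have hs : 0 < √X := Real.sqrt_pos.2 hX
  set F : ℝ → ℂ := fun θ => eulerInv (Complex.exp (-(saddleWidth X + θ * Complex.I))) *
    Complex.exp (n * (saddleWidth X + θ * Complex.I)) with hF
  have h := intervalIntegral.smul_integral_comp_mul_left (a := -√X) (b := √X) F
    (saddleWidth X / √X)
  rw [mul_neg, div_mul_cancel₀ _ hs.ne'] at h
  rw [← h, Complex.real_smul, saddleScale, Complex.ofReal_mul, mul_assoc]
  congr 1
  rw [← intervalIntegral.integral_const_mul]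
  refine intervalIntegral.integral_congr fun v _ => ?_
  simp only [hF]
  have e := circle_integrand_eq hX (v / √X) hn
  rw [show saddleWidth X / √X * v = saddleWidth X * (v / √X) by ring, e, saddleIntegrand]
  congr 5
  have : (X : ℂ) = (√X : ℂ) ^ 2 := by
    rw [← Complex.ofReal_pow, Real.sq_sqrt hX.le]
  have hs' : (√X : ℂ) ≠ 0 := by exact_mod_cast hs.ne'
  rw [this]
  push_cast
  field_simp

/-- On the minor arc the distance from `1` exceeds the radial distance by a fixed factor. -/
lemma norm_one_sub_exp_ge {τ θ : ℝ} (hτ : 0 < τ) (hτ2 : τ ≤ 1 / 2) (h1 : τ ≤ |θ|)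
    (h2 : |θ| ≤ Real.pi) :
    12 / 11 * (1 - Real.exp (-τ)) ≤ ‖1 - Complex.exp (-(τ + θ * Complex.I))‖ := by
  set r := Real.exp (-τ) with hr
  have hr1 : r < 1 := by rw [hr]; simpa using hτ
  have hr2 : 1 - r ≤ τ := by linarith [Real.add_one_le_exp (-τ)]
  have hr3 : 1 / 2 ≤ r := by linarith
  have hsq : ‖1 - Complex.exp (-(τ + θ * Complex.I))‖ ^ 2 =
      (1 - r) ^ 2 + 4 * r * Real.sin (|θ| / 2) ^ 2 := by
    have e : Complex.exp (-(τ + θ * Complex.I)) =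
        ((r * Real.cos θ : ℝ) : ℂ) - ((r * Real.sin θ : ℝ) : ℂ) * Complex.I := by
      rw [neg_add, Complex.exp_add, ← neg_mul, ← Complex.ofReal_neg θ, Complex.exp_mul_I,
        ← Complex.ofReal_neg, ← Complex.ofReal_exp, ← hr, ← Complex.ofReal_cos,
        ← Complex.ofReal_sin, Real.cos_neg, Real.sin_neg]
      push_cast
      ring
    have hc : Real.cos θ = 1 - 2 * Real.sin (|θ| / 2) ^ 2 := by
      rw [← Real.cos_abs θ]
      have := Real.cos_two_mul (|θ| / 2)
      rw [mul_div_cancel₀ _ (two_ne_zero' ℝ)] at this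
      rw [this, Real.cos_sq']
      ring
    rw [e, ← Complex.normSq_eq_norm_sq, Complex.normSq_apply]
    simp only [Complex.sub_re, Complex.one_re, Complex.ofReal_re, Complex.mul_re, Complex.I_re,
      mul_zero, Complex.ofReal_im, Complex.I_im, mul_one, sub_self, sub_zero, Complex.sub_im,
      Complex.one_im, Complex.mul_im, add_zero, zero_sub]
    have := Real.sin_sq_add_cos_sq θ
    have h4 : (1 - r * Real.cos θ) * (1 - r * Real.cos θ) + -(0 - r * Real.sin θ) *
        -(0 - r * Real.sin θ) = (1 - r) ^ 2 + 2 * r * (1 - Real.cos θ) := by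
      linear_combination r ^ 2 * this
    have h5 : 2 * r * (1 - Real.cos θ) = 4 * r * Real.sin (|θ| / 2) ^ 2 := by
      rw [hc]; ring
    rw [← h5, ← h4]
    ring
  have hsin : |θ| / Real.pi ≤ Real.sin (|θ| / 2) := by
    have := Real.mul_le_sin (x := |θ| / 2) (by positivity) (by linarith)
    calc |θ| / Real.pi = 2 / Real.pi * (|θ| / 2) := by ring
      _ ≤ _ := this
  have hpi : Real.pi ^ 2 ≤ 10 := by nlinarith [Real.pi_lt_d2, Real.pi_pos]
  have h6 : (1 - r) ^ 2 / 10 ≤ Real.sin (|θ| / 2) ^ 2 := by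
    calc (1 - r) ^ 2 / 10 ≤ |θ| ^ 2 / Real.pi ^ 2 := by
          gcongr
          linarith
      _ = (|θ| / Real.pi) ^ 2 := by rw [div_pow]
      _ ≤ _ := by gcongr
  refine le_of_sq_le_sq ?_ (norm_nonneg _)
  rw [hsq]
  nlinarith [sq_nonneg (1 - r), sq_nonneg (Real.sin (|θ| / 2))]

/-- For `τ ≤ |θ| ≤ π` the circle integrand is smaller than `√(τ/2π) e^{2X}` by an exponential factor
in `1/τ`. The hypothesis `hE` is provided by `eventually_eulerInv` for large `X`. -/
lemma minor_arc_norm_le {X θ : ℝ} (hX : 0 < X) (hτ2 : saddleWidth X ≤ 1 / 2)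
    (hE : ∀ q : ℂ, ‖q‖ ≤ Real.exp (-(12 * X)) → ‖eulerInv q‖ ≤ 2) {n : ℕ}
    (hn : (n : ℝ) = 1 / 24 + 6 * X ^ 2 / Real.pi ^ 2)
    (h1 : saddleWidth X ≤ |θ|) (h2 : |θ| ≤ Real.pi) :
    ‖eulerInv (Complex.exp (-(saddleWidth X + θ * Complex.I))) *
        Complex.exp (n * (saddleWidth X + θ * Complex.I))‖ ≤
      √(saddleWidth X / (2 * Real.pi)) * Real.exp (2 * X) * 2 *
        Real.exp (-(1 / (24 * saddleWidth X))) := by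
  have hτ := saddleWidth_pos hX
  have h0 := circle_integrand_eq hX 0 hn
  set τ := saddleWidth X with hτdef
  have hdist := norm_one_sub_exp_ge hτ hτ2 h1 h2
  set q : ℂ := Complex.exp (-(τ + θ * Complex.I)) with hq
  have hnq : ‖q‖ = Real.exp (-τ) := by
    rw [hq, Complex.norm_exp]; simp
  have hr1 : Real.exp (-τ) < 1 := by simpa using hτ
  have hr2 : 1 - Real.exp (-τ) ≤ τ := by linarith [Real.add_one_le_exp (-τ)]
  have hle := norm_eulerInv_le (q := q) (by rw [hnq]; exact hr1)
  rw [hnq] at hle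
  -- On the positive real axis the modular transformation is exact.
  have hreal : ‖eulerInv (Real.exp (-τ) : ℂ)‖ * Real.exp (n * τ) ≤
      √(τ / (2 * Real.pi)) * Real.exp (2 * X) * 2 := by
    have h3 := congrArg norm h0
    simp only [mul_zero, Complex.ofReal_zero, zero_mul, add_zero, norm_mul, div_one,
      Complex.one_cpow, one_mul, ne_eq, OfNat.ofNat_ne_zero, not_false_eq_true, zero_pow,
      neg_zero, Complex.exp_zero] at h3
    have e1 : Complex.exp (-(τ : ℂ)) = (Real.exp (-τ) : ℂ) := by push_cast; rfl
    have e2 : ‖Complex.exp (n * (τ : ℂ))‖ = Real.exp (n * τ) := by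
      rw [Complex.norm_exp]; simp
    have e3 : ‖Complex.exp (-(24 * X : ℂ))‖ ≤ Real.exp (-(12 * X)) := by
      rw [Complex.norm_exp, Real.exp_le_exp]
      simp
      linarith
    rw [e1, e2] at h3
    rw [h3, Complex.norm_real, Real.norm_of_nonneg (by positivity)]
    gcongr
    exact hE _ e3
  have hgain : 1 / (24 * τ) ≤ Real.exp (-τ) / (1 - Real.exp (-τ)) -
      Real.exp (-τ) / ‖1 - q‖ := by
    set r := Real.exp (-τ)
    have hd : 0 < 1 - r := by linarith
    have hr3 : 1 / 2 ≤ r := by linarith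
    have h4 : r / ‖1 - q‖ ≤ r / (12 / 11 * (1 - r)) := by gcongr
    have h5 : r / (1 - r) - r / (12 / 11 * (1 - r)) = r / (12 * (1 - r)) := by
      field_simp; norm_num
    have h6 : 1 / (24 * τ) ≤ r / (12 * (1 - r)) := by
      rw [div_le_div_iff₀ (by positivity) (by positivity)]
      nlinarith
    linarith
  have e4 : ‖Complex.exp (n * (τ + θ * Complex.I))‖ = Real.exp (n * τ) := by
    rw [Complex.norm_exp]; simp
  rw [norm_mul, e4]
  calc ‖eulerInv q‖ * Real.exp (n * τ)
      ≤ ‖eulerInv (Real.exp (-τ) : ℂ)‖ * Real.exp (-(1 / (24 * τ))) * Real.exp (n * τ) := by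
        gcongr
        refine hle.trans ?_
        gcongr
    _ = ‖eulerInv (Real.exp (-τ) : ℂ)‖ * Real.exp (n * τ) * Real.exp (-(1 / (24 * τ))) := by ring
    _ ≤ _ := by gcongr

/-- A bound for the integral over the minor arc, divided by `saddleScale X`. -/
def minorError (X : ℝ) : ℝ := 4 * Real.pi * √X / saddleWidth X *
  Real.exp (-(1 / (24 * saddleWidth X)))

lemma tendsto_saddleWidth : Tendsto saddleWidth atTop (𝓝 0) :=
  (tendsto_id.const_mul_atTop (by norm_num : (0 : ℝ) < 6)).const_div_atTop _

/-- Cauchy's integral, split into the major arc `|θ| ≤ τ` and the minor arc `τ ≤ |θ| ≤ π`. -/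
lemma norm_two_pi_mul_sub_le : ∀ᶠ X : ℝ in atTop, ∀ n : ℕ,
    (n : ℝ) = 1 / 24 + 6 * X ^ 2 / Real.pi ^ 2 →
      ‖(2 * Real.pi * partitionCount n : ℂ) / saddleScale X -
        ∫ v in (-√X)..√X, saddleIntegrand X v‖ ≤ minorError X := by
  have hsmall : ∀ᶠ X in atTop, saddleWidth X < 1 / 2 :=
    tendsto_saddleWidth.eventually_lt_const (by norm_num)
  filter_upwards [eventually_gt_atTop 0, hsmall, eventually_eulerInv] with X hX hτ2 hE n hn
  have hτ := saddleWidth_pos hX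
  have hS := saddleScale_pos hX
  have hS' : (saddleScale X : ℂ) ≠ 0 := by exact_mod_cast hS.ne'
  have hmaj := major_arc_eq hX hn
  have hcau := two_pi_mul_partitionCount n hτ
  have hmin := fun θ => minor_arc_norm_le (θ := θ) hX hτ2.le hE hn
  set τ := saddleWidth X with hτdef
  set F : ℝ → ℂ := fun θ => eulerInv (Complex.exp (-(τ + θ * Complex.I))) *
    Complex.exp (n * (τ + θ * Complex.I)) with hF
  have hFc : Continuous F :=
    (continuous_eulerInv_exp_neg (by fun_prop) fun x => by simpa using hτ).mul (by fun_prop)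
  have hπ : τ ≤ Real.pi := by linarith [Real.pi_gt_three]
  set B := √(τ / (2 * Real.pi)) * Real.exp (2 * X) * 2 * Real.exp (-(1 / (24 * τ))) with hB
  have hB0 : 0 ≤ B := by positivity
  have hint := fun a b => hFc.intervalIntegrable (μ := volume) a b
  have hsplit : ∫ θ in (-Real.pi)..Real.pi, F θ =
      (∫ θ in (-Real.pi)..(-τ), F θ) + (∫ θ in (-τ)..τ, F θ) + ∫ θ in τ..Real.pi, F θ := by
    rw [intervalIntegral.integral_add_adjacent_intervals (hint _ _) (hint _ _),
      intervalIntegral.integral_add_adjacent_intervals (hint _ _) (hint _ _)]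
  have hR : ‖∫ θ in τ..Real.pi, F θ‖ ≤ B * Real.pi := by
    refine (intervalIntegral.norm_integral_le_of_norm_le_const (C := B) fun θ hθ => ?_).trans ?_
    · rw [Set.uIoc_of_le hπ] at hθ
      have : |θ| = θ := abs_of_pos (hτ.trans hθ.1)
      exact hmin θ (by rw [this]; exact hθ.1.le) (by rw [this]; exact hθ.2)
    · gcongr
      rw [abs_of_nonneg] <;> linarith
  have hL : ‖∫ θ in (-Real.pi)..(-τ), F θ‖ ≤ B * Real.pi := by
    refine (intervalIntegral.norm_integral_le_of_norm_le_const (C := B) fun θ hθ => ?_).trans ?_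
    · rw [Set.uIoc_of_le (by linarith)] at hθ
      have : |θ| = -θ := abs_of_neg (by linarith [hθ.2])
      exact hmin θ (by rw [this]; linarith [hθ.2]) (by rw [this]; linarith [hθ.1])
    · gcongr
      rw [abs_of_nonneg] <;> linarith
  have key : (2 * Real.pi * partitionCount n : ℂ) / saddleScale X -
      ∫ v in (-√X)..√X, saddleIntegrand X v =
      ((∫ θ in (-Real.pi)..(-τ), F θ) + ∫ θ in τ..Real.pi, F θ) / saddleScale X := by
    rw [hcau, hsplit, hmaj]
    field_simp
    ring
  rw [key, norm_div, Complex.norm_real, Real.norm_of_nonneg hS.le, div_le_iff₀ hS]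
  calc _ ≤ B * Real.pi + B * Real.pi := (norm_add_le _ _).trans (add_le_add hL hR)
    _ = minorError X * saddleScale X := by
        have hs : 0 < √X := Real.sqrt_pos.2 hX
        rw [hB, minorError, saddleScale, ← hτdef]
        field_simp
        ring

lemma tendsto_minorError : Tendsto minorError atTop (𝓝 0) := by
  have h := (tendsto_rpow_mul_exp_neg_mul_atTop_nhds_zero (3 / 2) (1 / (4 * Real.pi ^ 2))
    (by positivity)).const_mul (24 / Real.pi)
  rw [mul_zero] at h
  refine h.congr' ?_
  filter_upwards [eventually_gt_atTop 0] with X hX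
  have e : X ^ (3 / 2 : ℝ) = X * √X := by
    rw [show (3 / 2 : ℝ) = 1 + 1 / 2 by norm_num, Real.rpow_add hX, Real.rpow_one,
      Real.sqrt_eq_rpow]
  have e2 : -(1 / (24 * saddleWidth X)) = -(1 / (4 * Real.pi ^ 2)) * X := by
    rw [saddleWidth]; field_simp; norm_num
  rw [minorError, e2, e, saddleWidth]
  field_simp
  norm_num

/-- The solution `X` of `n = 1/24 + 6 X² / π²`. -/
def saddleParam (n : ℕ) : ℝ := Real.pi / 12 * √(24 * n - 1)

lemma tendsto_saddleParam : Tendsto saddleParam atTop atTop := by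
  refine Tendsto.const_mul_atTop (by positivity) (Real.tendsto_sqrt_atTop.comp ?_)
  refine tendsto_atTop_add_const_right _ _ ?_
  exact tendsto_natCast_atTop_atTop.const_mul_atTop (by norm_num)

lemma saddleParam_sq {n : ℕ} (hn : 1 ≤ n) :
    saddleParam n ^ 2 = Real.pi ^ 2 / 144 * (24 * n - 1) := by
  have : (1 : ℝ) ≤ n := by exact_mod_cast hn
  rw [saddleParam, mul_pow, Real.sq_sqrt (by linarith)]
  ring

lemma tendsto_partitionCount_div : Tendsto
    (fun n : ℕ => 2 * Real.pi * partitionCount n / saddleScale (saddleParam n)) atTop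
      (𝓝 √Real.pi) := by
  have h1 := tendsto_integral_saddleIntegrand.comp tendsto_saddleParam
  have h2 : Tendsto (fun n : ℕ => (2 * Real.pi * partitionCount n : ℂ) /
      saddleScale (saddleParam n) -
        ∫ v in (-√(saddleParam n))..√(saddleParam n), saddleIntegrand (saddleParam n) v) atTop
      (𝓝 0) := by
    refine squeeze_zero_norm' ?_ (tendsto_minorError.comp tendsto_saddleParam)
    filter_upwards [tendsto_saddleParam.eventually norm_two_pi_mul_sub_le,
      eventually_ge_atTop 1] with n hn h1n
    refine hn n ?_
    rw [saddleParam_sq h1n]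
    field_simp
    ring
  have h3 := h2.add h1
  rw [zero_add] at h3
  have h4 := (Complex.continuous_re.tendsto _).comp h3
  rw [Complex.ofReal_re] at h4
  refine h4.congr fun n => ?_
  simp only [Function.comp_apply, sub_add_cancel]
  have : (2 * Real.pi * partitionCount n : ℂ) / saddleScale (saddleParam n) =
    ((2 * Real.pi * partitionCount n / saddleScale (saddleParam n) : ℝ) : ℂ) := by push_cast; rfl
  rw [this, Complex.ofReal_re]

/-- The Hardy–Ramanujan asymptotic formula. -/
lemma mul_partitionCount_isEquivalent :
    (fun n : ℕ => (n : ℝ) * partitionCount n) ~[atTop] fun n : ℕ => 1 / (4 * √3) *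
      Real.exp (Real.pi / 6 * √(24 * (n : ℝ) - 1)) := by
  refine (isEquivalent_iff_tendsto_one (Eventually.of_forall fun n => by positivity)).2 ?_
  have hn : Tendsto (fun n : ℕ => (24 * (n : ℝ) / (24 * n - 1))) atTop (𝓝 1) := by
    have h : Tendsto (fun n : ℕ => 1 + 1 / (24 * (n : ℝ) - 1)) atTop (𝓝 (1 + 0)) := by
      refine tendsto_const_nhds.add (Tendsto.const_div_atTop ?_ 1)
      refine tendsto_atTop_add_const_right _ _ ?_
      exact tendsto_natCast_atTop_atTop.const_mul_atTop (by norm_num)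
    rw [add_zero] at h
    refine h.congr' ?_
    filter_upwards [eventually_ge_atTop 1] with n hn
    have : (1 : ℝ) ≤ n := by exact_mod_cast hn
    have : 24 * (n : ℝ) - 1 ≠ 0 := by linarith
    field_simp
    ring
  have h := (tendsto_partitionCount_div.div_const √Real.pi).mul hn
  rw [div_self (by positivity), one_mul] at h
  refine h.congr' ?_
  filter_upwards [eventually_ge_atTop 1] with n hn1
  have h1 : (1 : ℝ) ≤ n := by exact_mod_cast hn1
  have hpos : (0 : ℝ) < 24 * n - 1 := by linarith
  have hsq := saddleParam_sq hn1
  have hX : 0 < saddleParam n := by unfold saddleParam; positivity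
  have hexp : Real.pi / 6 * √(24 * (n : ℝ) - 1) = 2 * saddleParam n := by
    rw [saddleParam]; ring
  have hden : 24 * (n : ℝ) - 1 = 144 * saddleParam n ^ 2 / Real.pi ^ 2 := by
    rw [hsq]; field_simp
  rw [Pi.div_apply, hexp, hden]
  set X := saddleParam n
  -- `(τ / √X) √(τ / 2π) √π = (π² / (12 √3)) / X²`, since `τ = π² / (6 X)`.
  have hscale : saddleScale X * √Real.pi = Real.pi ^ 3 / (12 * √3 * X ^ 2) * Real.exp (2 * X) := by
    have e : √(saddleWidth X / (2 * Real.pi)) = √Real.pi / (2 * √3 * √X) := by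
      have : saddleWidth X / (2 * Real.pi) = (√Real.pi / (2 * √3 * √X)) ^ 2 := by
        rw [div_pow, mul_pow, mul_pow, Real.sq_sqrt Real.pi_pos.le, Real.sq_sqrt hX.le,
          Real.sq_sqrt (by norm_num), saddleWidth]
        field_simp
        norm_num
      rw [this, Real.sqrt_sq (by positivity)]
    have hsX := Real.mul_self_sqrt hX.le
    have hsπ := Real.mul_self_sqrt Real.pi_pos.le
    have hs : 0 < √X := Real.sqrt_pos.2 hX
    rw [saddleScale, e, saddleWidth]
    field_simp
    nlinarith
  have hS := saddleScale_pos hX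
  have : 2 * Real.pi * partitionCount n / saddleScale X / √Real.pi =
      2 * Real.pi * partitionCount n / (saddleScale X * √Real.pi) := by rw [div_div]
  rw [this, hscale]
  field_simp
  ring

end

/-! ### Comparison of the rank moment with the partition function -/

section

open Topology Finset

/-- The exponent in `p(n) ≈ e^{β √n}`, namely `π √(2/3)`. -/
def growthRate : ℝ := Real.pi / 6 * √24

lemma growthRate_pos : 0 < growthRate := by unfold growthRate; positivity

lemma exp_saddle_le (n : ℕ) :
    Real.exp (Real.pi / 6 * √(24 * (n : ℝ) - 1)) ≤ Real.exp (growthRate * √n) := by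
  rw [growthRate, mul_assoc, ← Real.sqrt_mul (by norm_num)]
  gcongr
  linarith

lemma le_exp_saddle {n : ℕ} (hn : 1 ≤ n) : Real.exp (growthRate * √n) ≤
    Real.exp (Real.pi / 6) * Real.exp (Real.pi / 6 * √(24 * (n : ℝ) - 1)) := by
  have h1 : (1 : ℝ) ≤ n := by exact_mod_cast hn
  rw [growthRate, mul_assoc, ← Real.sqrt_mul (by norm_num), ← Real.exp_add]
  have h : √(24 * (n : ℝ)) ≤ 1 + √(24 * (n : ℝ) - 1) := by
    rw [Real.sqrt_le_left (by positivity)]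
    have := Real.sq_sqrt (show (0 : ℝ) ≤ 24 * n - 1 by linarith)
    nlinarith [Real.sqrt_nonneg (24 * (n : ℝ) - 1)]
  gcongr
  nlinarith [Real.pi_pos]

lemma exists_lower_bound : ∃ c > 0, ∀ᶠ n : ℕ in atTop,
    c * Real.exp (growthRate * √n) ≤ n * partitionCount n := by
  obtain ⟨C, hC, h⟩ := mul_partitionCount_isEquivalent.symm.isBigO.exists_pos
  refine ⟨(C * (4 * √3) * Real.exp (Real.pi / 6))⁻¹, by positivity, ?_⟩
  filter_upwards [h.bound, eventually_ge_atTop 1] with n hn h1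
  rw [Real.norm_of_nonneg (by positivity), Real.norm_of_nonneg (by positivity)] at hn
  rw [inv_mul_le_iff₀ (by positivity)]
  calc _ ≤ _ := le_exp_saddle h1
    _ = Real.exp (Real.pi / 6) * (4 * √3) *
        (1 / (4 * √3) * Real.exp (Real.pi / 6 * √(24 * (n : ℝ) - 1))) := by
      field_simp
    _ ≤ Real.exp (Real.pi / 6) * (4 * √3) * (C * (n * partitionCount n)) := by gcongr
    _ = _ := by ring

lemma exists_upper_bound : ∃ C > 0, ∀ n : ℕ,
    ((n : ℝ) + 1) * partitionCount n ≤ C * Real.exp (growthRate * √n) := by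
  have h : (fun n : ℕ => ((n : ℝ) + 1) * partitionCount n) =O[atTop]
      fun n : ℕ => Real.exp (growthRate * √n) := by
    have h1 : (fun n : ℕ => ((n : ℝ) + 1) * partitionCount n) =O[atTop]
        fun n : ℕ => (n : ℝ) * partitionCount n := by
      refine IsBigO.of_bound 2 ?_
      filter_upwards [eventually_ge_atTop 1] with n hn
      have : (1 : ℝ) ≤ n := by exact_mod_cast hn
      rw [Real.norm_of_nonneg (by positivity), Real.norm_of_nonneg (by positivity), ← mul_assoc]
      gcongr
      linarith
    refine (h1.trans mul_partitionCount_isEquivalent.isBigO).trans ?_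
    refine IsBigO.of_bound (1 / (4 * √3)) (Eventually.of_forall fun n => ?_)
    rw [Real.norm_of_nonneg (by positivity), Real.norm_of_nonneg (by positivity)]
    exact mul_le_mul_of_nonneg_left (exp_saddle_le n) (by positivity)
  obtain ⟨C, hC, h2⟩ := bound_of_isBigO_nat_atTop h
  refine ⟨C, hC, fun n => ?_⟩
  have := h2 (x := n) (Real.exp_pos _).ne'
  rwa [Real.norm_of_nonneg (by positivity), Real.norm_of_nonneg (by positivity)] at this

/-- Removing `m` from `n` costs a factor exponential in `m / √n`. -/
lemma exists_partitionCount_sub_le : ∃ D > 0, ∀ᶠ n : ℕ in atTop, ∀ m ≤ n,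
    (partitionCount (n - m) : ℝ) ≤
      D * partitionCount n * Real.exp (-(growthRate / 4 * m / √n)) := by
  obtain ⟨c, hc, hlow⟩ := exists_lower_bound
  obtain ⟨C, hC, hup⟩ := exists_upper_bound
  have hb := growthRate_pos
  set b := growthRate
  refine ⟨C / c * (2 + 128 / b ^ 2), by positivity, ?_⟩
  filter_upwards [hlow, eventually_ge_atTop 1] with n hn h1 m hm
  have hn1 : (1 : ℝ) ≤ n := by exact_mod_cast h1
  have hy : 0 < √(n : ℝ) := Real.sqrt_pos.2 (by linarith)
  have hy2 : √(n : ℝ) ^ 2 = n := Real.sq_sqrt (by linarith)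
  have hm' : (m : ℝ) ≤ n := by exact_mod_cast hm
  have hM := hup (n - m)
  rw [Nat.cast_sub hm] at hM
  have hsub : √((n : ℝ) - m) ≤ √n - m / (2 * √n) := by
    refine Real.sqrt_le_iff.2 ⟨?_, ?_⟩
    · rw [sub_nonneg, div_le_iff₀ (by positivity)]
      nlinarith
    · have : (√(n : ℝ) - m / (2 * √n)) ^ 2 = n - m + (m / (2 * √n)) ^ 2 := by
        rw [sub_sq, hy2]; field_simp
      rw [this]
      nlinarith [sq_nonneg ((m : ℝ) / (2 * √n))]
  set u := (m : ℝ) / √n with hu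
  have hu0 : 0 ≤ u := by positivity
  have hexp : Real.exp (b * √((n : ℝ) - m)) ≤ Real.exp (b * √n) * Real.exp (-(b * u / 2)) := by
    rw [← Real.exp_add, Real.exp_le_exp]
    have : (m : ℝ) / (2 * √n) = u / 2 := by rw [hu]; ring
    rw [this] at hsub
    nlinarith
  have hfac : (n : ℝ) ≤ (2 + 128 / b ^ 2) * Real.exp (b * u / 4) * (n - m + 1) := by
    have he1 : 1 ≤ Real.exp (b * u / 4) := Real.one_le_exp (by positivity)
    have h128 : (0 : ℝ) ≤ 128 / b ^ 2 := by positivity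
    rcases le_or_gt (2 * (m : ℝ)) n with h | h
    · calc (n : ℝ) ≤ 2 * 1 * (n - m + 1) := by linarith
        _ ≤ _ := by gcongr; linarith
    · have h3 : √(n : ℝ) / 2 ≤ u := by
        rw [hu, le_div_iff₀ hy]; nlinarith
      have h4 : (n : ℝ) ≤ 128 / b ^ 2 * Real.exp (b * √n / 8) := by
        have h5 := Real.quadratic_le_exp_of_nonneg (x := b * √n / 8) (by positivity)
        have h6 : (b * √n / 8) ^ 2 / 2 ≤ Real.exp (b * √n / 8) := by
          have : 0 ≤ b * √n / 8 := by positivity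
          linarith
        calc (n : ℝ) = 128 / b ^ 2 * ((b * √n / 8) ^ 2 / 2) := by
              rw [div_pow, mul_pow, hy2]; field_simp; norm_num
          _ ≤ _ := by gcongr
      have h7 : Real.exp (b * √n / 8) ≤ Real.exp (b * u / 4) := by
        rw [Real.exp_le_exp]; nlinarith
      calc (n : ℝ) ≤ 128 / b ^ 2 * Real.exp (b * √n / 8) := h4
        _ ≤ (2 + 128 / b ^ 2) * Real.exp (b * u / 4) * 1 := by
          rw [mul_one]; gcongr; linarith
        _ ≤ _ := by gcongr; linarith
  have hpos : (0 : ℝ) < n - m + 1 := by linarith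
  have hE : Real.exp (-(b * u / 2)) * Real.exp (b * u / 4) = Real.exp (-(b / 4 * m / √n)) := by
    rw [← Real.exp_add]; congr 1; rw [hu]; ring
  rw [← hE]
  refine le_of_mul_le_mul_left ?_ hpos
  calc ((n : ℝ) - m + 1) * partitionCount (n - m) ≤ C * Real.exp (b * √((n : ℝ) - m)) := hM
    _ ≤ C * (Real.exp (b * √n) * Real.exp (-(b * u / 2))) := by gcongr
    _ = C / c * Real.exp (-(b * u / 2)) * (c * Real.exp (b * √n)) := by field_simp
    _ ≤ C / c * Real.exp (-(b * u / 2)) * (n * partitionCount n) := by gcongr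
    _ = C / c * Real.exp (-(b * u / 2)) * partitionCount n * n := by ring
    _ ≤ C / c * Real.exp (-(b * u / 2)) * partitionCount n *
        ((2 + 128 / b ^ 2) * Real.exp (b * u / 4) * (n - m + 1)) := by gcongr
    _ = _ := by ring

lemma sum_mul_exp_le {u : ℝ} (hu : 0 < u) (s : Finset ℕ) :
    ∑ j ∈ s, (j : ℝ) * Real.exp (-u) ^ j ≤ 1 / u ^ 2 := by
  have hr : ‖Real.exp (-u)‖ < 1 := by
    rw [Real.norm_of_nonneg (Real.exp_pos _).le]; simpa using hu
  have h := hasSum_coe_mul_geometric_of_norm_lt_one hr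
  refine (sum_le_hasSum s (fun j _ => by positivity) h).trans ?_
  -- `e^{-u} / (1 - e^{-u})² = 1 / (2 sinh (u/2))²` and `sinh (u/2) ≥ u/2`.
  have hsinh := (Real.self_le_sinh_iff (x := u / 2)).2 (by positivity)
  rw [Real.sinh_eq] at hsinh
  set v := Real.exp (-(u / 2)) with hv
  have hv0 : 0 < v := Real.exp_pos _
  have e1 : Real.exp (-u) = v ^ 2 := by
    rw [hv, ← Real.exp_nat_mul]; congr 1; push_cast; ring
  have e2 : Real.exp (u / 2) * v = 1 := by rw [hv, ← Real.exp_add]; simp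
  have h2 : u * v ≤ 1 - v ^ 2 := by nlinarith
  rw [e1, div_le_div_iff₀ (pow_pos (by nlinarith [mul_pos hu hv0]) 2) (by positivity)]
  have := pow_le_pow_left₀ (by positivity) h2 2
  nlinarith

/-- The multiples of `i` contribute at most `O(n p(n) / i²)` to `n p(n)`. -/
lemma exists_coeff_weighted_le : ∃ D > 0, ∀ᶠ n : ℕ in atTop, ∀ i : ℕ, 0 < i →
    ((PowerSeries.coeff n (partGF * weighted i) : ℤ) : ℝ) ≤
      D * (n * partitionCount n) * ((i : ℝ) ^ 2)⁻¹ := by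
  obtain ⟨D, hD, h⟩ := exists_partitionCount_sub_le
  have hb := growthRate_pos
  refine ⟨D * (4 / growthRate) ^ 2, by positivity, ?_⟩
  filter_upwards [h, eventually_ge_atTop 1] with n hn h1 i hi
  have hn1 : (1 : ℝ) ≤ n := by exact_mod_cast h1
  have hi' : (0 : ℝ) < i := by exact_mod_cast hi
  have hy2 : √(n : ℝ) ^ 2 = n := Real.sq_sqrt (by linarith)
  set u := growthRate / 4 * i / √n with hu
  have hu0 : 0 < u := by positivity
  rw [coeff_partGF_mul_weighted hi]
  push_cast
  calc ∑ j ∈ range (n + 1), (if i * j ≤ n then (j : ℝ) * partitionCount (n - i * j) else 0)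
      ≤ ∑ j ∈ range (n + 1), D * partitionCount n * ((j : ℝ) * Real.exp (-u) ^ j) := by
        refine sum_le_sum fun j _ => ?_
        split_ifs with hj
        · have := hn _ hj
          have e : Real.exp (-(growthRate / 4 * ((i * j : ℕ) : ℝ) / √n)) = Real.exp (-u) ^ j := by
            rw [← Real.exp_nat_mul]; congr 1; rw [hu]; push_cast; ring
          rw [e] at this
          calc (j : ℝ) * partitionCount (n - i * j)
              ≤ j * (D * partitionCount n * Real.exp (-u) ^ j) := by gcongr
            _ = _ := by ring
        · positivity
    _ = D * partitionCount n * ∑ j ∈ range (n + 1), (j : ℝ) * Real.exp (-u) ^ j := by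
        rw [mul_sum]
    _ ≤ D * partitionCount n * (1 / u ^ 2) := by gcongr; exact sum_mul_exp_le hu0 _
    _ = _ := by
        rw [hu, div_pow, mul_pow, hy2]
        field_simp

lemma tendsto_pow_mul_exp_neg_sqrt (k : ℕ) :
    Tendsto (fun n : ℕ => ((n : ℝ) + 1) ^ k * Real.exp (-(growthRate * √n))) atTop (𝓝 0) := by
  have hb := growthRate_pos
  have hx : Tendsto (fun n : ℕ => growthRate * √(n : ℝ)) atTop atTop :=
    (Real.tendsto_sqrt_atTop.comp tendsto_natCast_atTop_atTop).const_mul_atTop hb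
  have h := ((Real.tendsto_pow_mul_exp_neg_atTop_nhds_zero (2 * k)).comp hx).const_mul
    ((2 / growthRate ^ 2) ^ k)
  rw [mul_zero] at h
  refine squeeze_zero' (Eventually.of_forall fun n => by positivity) ?_ h
  filter_upwards [eventually_ge_atTop 1] with n hn
  have hn1 : (1 : ℝ) ≤ n := by exact_mod_cast hn
  have hy2 : √(n : ℝ) ^ 2 = n := Real.sq_sqrt (by linarith)
  simp only [Function.comp_apply]
  rw [← mul_assoc, pow_mul, ← mul_pow, mul_pow growthRate, hy2]
  have : 2 / growthRate ^ 2 * (growthRate ^ 2 * (n : ℝ)) = 2 * n := by field_simp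
  rw [this]
  gcongr
  linarith

lemma smallPart_isLittleO (K : ℕ) {ε : ℝ} (hε : 0 < ε) : ∀ᶠ n : ℕ in atTop,
    ((PowerSeries.coeff n (smallPart K) : ℤ) : ℝ) ≤ ε * (n * partitionCount n) := by
  obtain ⟨B, k, hB⟩ := exists_coeff_smallPart_le K
  obtain ⟨c, hc, hlow⟩ := exists_lower_bound
  have h := (tendsto_pow_mul_exp_neg_sqrt k).const_mul (B : ℝ)
  rw [mul_zero] at h
  filter_upwards [hlow, h.eventually_lt_const (by positivity : (0 : ℝ) < ε * c)] with n h1 h2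
  have h3 : ((PowerSeries.coeff n (smallPart K) : ℤ) : ℝ) ≤ B * ((n : ℝ) + 1) ^ k := by
    exact_mod_cast hB n
  have e : Real.exp (-(growthRate * √n)) * Real.exp (growthRate * √n) = 1 := by
    rw [← Real.exp_add]; simp
  calc _ ≤ (B : ℝ) * ((n : ℝ) + 1) ^ k := h3
    _ = B * (((n : ℝ) + 1) ^ k * Real.exp (-(growthRate * √n))) * Real.exp (growthRate * √n) := by
      rw [mul_assoc, mul_assoc, e, mul_one]
    _ ≤ ε * c * Real.exp (growthRate * √n) := by gcongr
    _ = ε * (c * Real.exp (growthRate * √n)) := by ring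
    _ ≤ _ := by gcongr

lemma sum_inv_sq_le {K n : ℕ} (hK : 0 < K) (h : K ≤ n) :
    ∑ i ∈ Ico K n, (((i + 1 : ℕ) : ℝ) ^ 2)⁻¹ ≤ (K : ℝ)⁻¹ := by
  have h1 := sum_Ioc_inv_sq_le_sub (α := ℝ) hK.ne' h
  have h2 : ∑ i ∈ Ico K n, (((i + 1 : ℕ) : ℝ) ^ 2)⁻¹ = ∑ i ∈ Ioc K n, ((i : ℝ) ^ 2)⁻¹ := by
    rw [sum_Ico_add' (fun i : ℕ => ((i : ℝ) ^ 2)⁻¹) K n 1]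
    congr 1
    ext i
    simp only [mem_Ico, mem_Ioc]
    omega
  have h3 : (0 : ℝ) ≤ (n : ℝ)⁻¹ := by positivity
  linarith

lemma eta2_isEquivalent_mul_partitionCount :
    (fun n : ℕ => (eta2 n : ℝ)) ~[atTop] fun n : ℕ => (n : ℝ) * (partitionCount n : ℝ) := by
  obtain ⟨D, hD, hw⟩ := exists_coeff_weighted_le
  refine isLittleO_iff.2 fun ε hε => ?_
  obtain ⟨K, hK⟩ := exists_nat_gt (2 * D / ε)
  have hK0 : 0 < K := by
    have : (0 : ℝ) < K := lt_trans (by positivity) hK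
    exact_mod_cast this
  filter_upwards [hw, smallPart_isLittleO K (half_pos hε), eventually_ge_atTop K] with n h1 h2 h3
  have hK' : (0 : ℝ) < K := by exact_mod_cast hK0
  have hle : (eta2 n : ℝ) ≤ n * partitionCount n := by exact_mod_cast eta2_le n
  have hge : (n : ℝ) * partitionCount n ≤ eta2 n + (PowerSeries.coeff n (smallPart K) : ℤ) +
      ∑ i ∈ Ico K (n + 1), ((PowerSeries.coeff n (partGF * weighted (i + 1)) : ℤ) : ℝ) := by
    exact_mod_cast le_eta2_add h3
  have htail : ∑ i ∈ Ico K (n + 1), ((PowerSeries.coeff n (partGF * weighted (i + 1)) : ℤ) : ℝ) ≤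
      ε / 2 * (n * partitionCount n) := by
    calc _ ≤ ∑ i ∈ Ico K (n + 1), D * (n * partitionCount n) * (((i + 1 : ℕ) : ℝ) ^ 2)⁻¹ :=
          sum_le_sum fun i _ => h1 _ i.succ_pos
      _ = D * (n * partitionCount n) * ∑ i ∈ Ico K (n + 1), (((i + 1 : ℕ) : ℝ) ^ 2)⁻¹ := by
          rw [mul_sum]
      _ ≤ D * (n * partitionCount n) * (K : ℝ)⁻¹ := by
          gcongr
          exact sum_inv_sq_le hK0 (by omega)
      _ = D * (K : ℝ)⁻¹ * (n * partitionCount n) := by ring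
      _ ≤ _ := by
          gcongr
          rw [div_lt_iff₀ hε] at hK
          rw [← div_eq_mul_inv, div_le_iff₀ hK']
          linarith
  rw [Pi.sub_apply, Real.norm_eq_abs, abs_of_nonpos (by linarith),
    Real.norm_of_nonneg (by positivity)]
  linarith

end

end PartitionRank

end

theorem corollary1p3 :
    ((fun n : ℕ => (eta2 n : ℝ)) ~[atTop]
      fun n : ℕ => 1 / (4 * Real.sqrt 3) *
        Real.exp (Real.pi / 6 * Real.sqrt (24 * (n : ℝ) - 1))) ∧
    ((fun n : ℕ => (eta2 n : ℝ)) ~[atTop]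
      fun n : ℕ => (n : ℝ) * (partitionCount n : ℝ)) :=
  ⟨PartitionRank.eta2_isEquivalent_mul_partitionCount.trans
      PartitionRank.mul_partitionCount_isEquivalent,
    PartitionRank.eta2_isEquivalent_mul_partitionCount⟩
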